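/- Let $I=\,]a,b[\,\subseteq\mathbb{R}$ be an open interval (possibly unbounded), and let $\varphi:I\to\mathbb{R}$ be a smooth, strictly increasing function such that $$\ddot\varphi+\lambda\,\dot\varphi^{2}\ge 0\quad\text{on } I\qquad\text{for some constant }\lambda>0 .$$ Let $\Sigma$ be a connected smooth surface without boundary and let $f:\Sigma\to\mathbb{R}^{2}\times I\subseteq\mathbb{R}^{3}$ be a smooth immersion with smooth unit normal field (Gauss map) $N:\Sigma\to\mathbb{S}^{2}$. Let $H$ be its mean curvature, i.e. the trace, with respect to the first fundamental form $\langle df(u),df(v)\rangle$, of the second fundamental form $\mathcal{S}(u,v)=\langle dN(u),df(v)\rangle$. Assume that $f$ is a $[\varphi,\vec e_3]$-minimal immersion, that is, $$H=-\langle\overline\nabla\varphi,N\rangle=-\dot\varphi\,\langle N,\vec e_3\rangle ,$$ where $\varphi$ is regarded as the function $(x_1,x_2,x_3)\mapsto\varphi(x_3)$ on $\mathbb{R}^2\times I$, $\overline\nabla$ is the gradient of $\mathbb{R}^3$, $\vec e_3=(0,0,1)$, and $\dot\varphi$, $\langle N,\vec e_3\rangle$ are taken at $f(p)$ and $p$ respectively.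 Assume also that $H\le 0$ on $\Sigma$. If $H$ vanishes at some point of $\Sigma$, then $H$ vanishes identically and $f(\Sigma)$ is contained in a vertical plane (an affine plane of $\mathbb{R}^3$ parallel to $\vec e_3$). -/

import Mathlib

open scoped Manifold ContDiff

/-- Euclidean three-space. -/
abbrev E3 : Type := EuclideanSpace ℝ (Fin 3)

/-- The vertical unit vector `(0, 0, 1)`. -/
noncomputable def e3 : E3 := EuclideanSpace.single 2 1

section Surface

variable {M : Type*} [TopologicalSpace M] [ChartedSpace (EuclideanSpace ℝ (Fin 2)) M]

/-- The differential at `p` of an `ℝ³`-valued map on the surface `M`. The tangent plane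
`TangentSpace (𝓡 2) p` is by definition a copy of the model space `ℝ²` (the identification being
given by the preferred chart at `p`), and is written as such here. -/
noncomputable def surfDiff (f : M → E3) (p : M) : EuclideanSpace ℝ (Fin 2) →L[ℝ] E3 :=
  mfderiv (𝓡 2) 𝓘(ℝ, E3) f p

/-- The first fundamental form `⟨df u, df v⟩` of `f` at `p`. -/
noncomputable def firstForm (f : M → E3) (p : M) (u v : EuclideanSpace ℝ (Fin 2)) : ℝ :=
  inner ℝ (surfDiff f p u) (surfDiff f p v)

/-- The second fundamental form `⟨dN u, df v⟩` of `f` at `p` with respect to the Gauss map `N`.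
In this sign convention the mean curvature vector is `-H N`. -/
noncomputable def secondForm (f N : M → E3) (p : M) (u v : EuclideanSpace ℝ (Fin 2)) : ℝ :=
  inner ℝ (surfDiff N p u) (surfDiff f p v)

/-- The basis of the tangent plane given by the coordinate vectors of the preferred chart. -/
noncomputable def coordVec (i : Fin 2) : EuclideanSpace ℝ (Fin 2) :=
  EuclideanSpace.single i 1

/-- The mean curvature (the sum of the two principal curvatures): the trace of the second
fundamental form with respect to the first one. For an immersion this trace does not depend on
the basis in which the two Gram matrices are taken. -/
noncomputable def meanCurvature (f N : M → E3) (p : M) : ℝ :=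
  ((Matrix.of fun i j => firstForm f p (coordVec i) (coordVec j))⁻¹ *
    Matrix.of fun i j => secondForm f N p (coordVec i) (coordVec j)).trace

/-- `f : M → ℝ³` is a smooth immersion of the surface `M`. -/
structure IsSmoothImmersion (f : M → E3) : Prop where
  smooth : ContMDiff (𝓡 2) 𝓘(ℝ, E3) ∞ f
  injective_diff : ∀ p, Function.Injective (surfDiff f p)

/-- `N` is a (globally defined, smooth) Gauss map of `f`: a unit normal field along `f`. -/
structure IsGaussMap (f N : M → E3) : Prop where
  smooth : ContMDiff (𝓡 2) 𝓘(ℝ, E3) ∞ N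
  norm_eq_one : ∀ p, ‖N p‖ = 1
  normal : ∀ p v, inner ℝ (surfDiff f p v) (N p) = 0

/-- The immersion `f` with Gauss map `N` is a `[φ, e₃]`-minimal immersion in `ℝ² × I`:
`H = -⟨∇φ, N⟩`, where `φ` is regarded as the function `x ↦ φ(x₃)` on `ℝ² × I` and `∇` is the
gradient of `ℝ³`. -/
structure IsPhiMinimal (φ : ℝ → ℝ) (I : Set ℝ) (f N : M → E3) : Prop where
  immersion : IsSmoothImmersion f
  gaussMap : IsGaussMap f N
  mem_slab : ∀ p, f p 2 ∈ I
  meanCurvature_eq : ∀ p,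
    meanCurvature f N p = -inner ℝ (gradient (fun x : E3 => φ (x 2)) (f p)) (N p)

end Surface

/-- A vertical plane of `ℝ³`: an affine plane parallel to `e₃`. -/
def IsVerticalPlane (P : AffineSubspace ℝ E3) : Prop :=
  Module.finrank ℝ P.direction = 2 ∧ e3 ∈ P.direction

/-! The proof studies the angle function `u = ⟨N, e₃⟩`. Since `exp (λ φ) φ'` is monotone, a
nonpositive slope at one point would force nonpositive slopes to its left, against strict
monotonicity. Hence `φ' > 0` (`deriv_pos_of_strictMonoOn_of_nonneg`), and `H = -φ' u` turns the
assumptions on `H` into `u ≥ 0` with a zero of `u`.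

Differentiating the mean curvature equation and using Codazzi shows that in any chart `u` solves a
linear elliptic equation whose zeroth-order coefficient combines `φ''` with the squared length of
`dN` (`normal_component_jet_equation`, `normal_component_patch_equation`). The sign of that
coefficient is irrelevant: a nonnegative solution that vanishes at a point vanishes nearby
(`eventually_eq_zero_of_nonneg_supersolution`, by a Hopf barrier). So the zero set of `u` is open
and closed, and connectedness gives `u = 0`, hence `H = 0`.

Now `e₃` is tangent everywhere. Differentiating `⟨N, e₃⟩ = 0` puts `e₃` in the kernel of the second
fundamental form, which is also trace-free and therefore zero (`normal_jet_eq_zero`). Thus `N` is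
constant, `⟨f, N⟩` is constant, and the image lies in a plane orthogonal to `N`, to which `e₃` is
parallel. -/

open Filter Topology Metric Set in
/-- Necessary second-order condition at a local minimum of a function of one variable. -/
theorem IsLocalMin.nonneg_of_hasDerivAt_hasDerivAt {g g' : ℝ → ℝ} {x s : ℝ}
    (hmin : IsLocalMin g x) (hg : ∀ᶠ t in 𝓝 x, HasDerivAt g (g' t) t)
    (hs : HasDerivAt g' s x) : 0 ≤ s := by
  by_contra! hneg
  have hd : deriv g =ᶠ[𝓝 x] g' := hg.mono fun t ht => ht.deriv
  have hdd : deriv (deriv g) x = s := by rw [hd.deriv_eq, hs.deriv]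
  -- A negative second derivative makes the minimum a local maximum as well, so `g` is locally
  -- constant and the second derivative is zero after all.
  have hmax : IsLocalMax g x :=
    isLocalMax_of_deriv_deriv_neg (by rw [hdd]; exact hneg) hmin.deriv_eq_zero
      hg.self_of_nhds.continuousAt
  have hconst : g =ᶠ[𝓝 x] fun _ => g x := by
    filter_upwards [hmin, hmax] with t h1 h2 using le_antisymm h2 h1
  have h0 : deriv g =ᶠ[𝓝 x] fun _ => 0 := by
    simpa using hconst.deriv
  have : deriv (deriv g) x = 0 := by simpa using h0.deriv_eq
  linarith

/-! ### Hopf's strong minimum principle. -/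

section MaximumPrinciple

variable {E : Type*} [NormedAddCommGroup E] [InnerProductSpace ℝ E]

/-- The first derivative along a line of a function of class `C²`. -/
theorem ContDiffAt.eventually_hasDerivAt_line {u : E → ℝ} {x : E} (hu : ContDiffAt ℝ 2 u x)
    (v : E) : ∀ᶠ t in nhds (0 : ℝ),
      HasDerivAt (fun t : ℝ => u (x + t • v)) (fderiv ℝ u (x + t • v) v) t := by
  have hc : Filter.Tendsto (fun t : ℝ => x + t • v) (nhds 0) (nhds x) := by
    have : Continuous fun t : ℝ => x + t • v := by fun_prop
    simpa using this.tendsto 0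
  have hev : ∀ᶠ y in nhds x, DifferentiableAt ℝ u y :=
    (hu.eventually (by simp)).mono fun y hy => hy.differentiableAt (by simp)
  filter_upwards [hc.eventually hev] with t ht
  have hl : HasDerivAt (fun t : ℝ => x + t • v) v t := by
    simpa using ((hasDerivAt_id t).smul_const v).const_add x
  exact ht.hasFDerivAt.comp_hasDerivAt t hl

/-- The second derivative along a line of a function of class `C²`. -/
theorem ContDiffAt.hasDerivAt_fderiv_line {u : E → ℝ} {x : E} (hu : ContDiffAt ℝ 2 u x) (v : E) :
    HasDerivAt (fun t : ℝ => fderiv ℝ u (x + t • v) v) (fderiv ℝ (fderiv ℝ u) x v v) 0 := by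
  have hd : HasFDerivAt (fderiv ℝ u) (fderiv ℝ (fderiv ℝ u) x) (x + (0 : ℝ) • v) := by
    rw [zero_smul, add_zero]
    exact ((hu.fderiv_right (m := 1) (by norm_num)).differentiableAt (by simp)).hasFDerivAt
  have hl : HasDerivAt (fun t : ℝ => x + t • v) v 0 := by
    simpa using ((hasDerivAt_id (0 : ℝ)).smul_const v).const_add x
  exact (ContinuousLinearMap.apply ℝ ℝ v).hasFDerivAt.comp_hasDerivAt (0 : ℝ)
    (hd.comp_hasDerivAt (0 : ℝ) hl)

/-- The Gaussian barrier along a line: first derivative. -/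
theorem hasDerivAt_exp_neg_sq_line (a : ℝ) (d v : E) (t : ℝ) :
    HasDerivAt (fun t : ℝ => Real.exp (-a * ‖d + t • v‖ ^ 2))
      (Real.exp (-a * ‖d + t • v‖ ^ 2) * (-a * (2 * inner ℝ (d + t • v) v))) t := by
  have hl : HasDerivAt (fun t : ℝ => d + t • v) v t := by
    simpa using ((hasDerivAt_id t).smul_const v).const_add d
  exact ((hl.norm_sq).const_mul (-a)).exp

/-- The Gaussian barrier along a line: second derivative at the origin. -/
theorem hasDerivAt_exp_neg_sq_line_deriv (a : ℝ) (d v : E) :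
    HasDerivAt (fun t : ℝ => Real.exp (-a * ‖d + t • v‖ ^ 2) * (-a * (2 * inner ℝ (d + t • v) v)))
      (Real.exp (-a * ‖d‖ ^ 2) * (4 * a ^ 2 * inner ℝ d v ^ 2 - 2 * a * ‖v‖ ^ 2)) 0 := by
  have hl : HasDerivAt (fun t : ℝ => d + t • v) v 0 := by
    simpa using ((hasDerivAt_id (0 : ℝ)).smul_const v).const_add d
  have h1 := hasDerivAt_exp_neg_sq_line a d v 0
  have h2 := ((hl.inner ℝ (hasDerivAt_const (0 : ℝ) v)).const_mul 2).const_mul (-a)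
  refine (h1.mul h2).congr_deriv ?_
  simp only [zero_smul, add_zero, inner_zero_right, zero_add, real_inner_self_eq_norm_sq]
  ring

/-- A function of class `C²` touched from below by a multiple of the Gaussian barrier: comparison
of the first and second derivatives at the touching point. -/
theorem derivatives_of_isLocalMin_sub_exp {u : E → ℝ} {x q : E} {a ε m : ℝ}
    (hu : ContDiffAt ℝ 2 u x)
    (hmin : IsLocalMin (fun y => u y - ε * (Real.exp (-a * ‖y - q‖ ^ 2) - m)) x) (v : E) :
    fderiv ℝ u x v = ε * (Real.exp (-a * ‖x - q‖ ^ 2) * (-2 * a * inner ℝ (x - q) v)) ∧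
    ε * (Real.exp (-a * ‖x - q‖ ^ 2) * (4 * a ^ 2 * inner ℝ (x - q) v ^ 2 - 2 * a * ‖v‖ ^ 2)) ≤
      fderiv ℝ (fderiv ℝ u) x v v := by
  have hc : Filter.Tendsto (fun t : ℝ => x + t • v) (nhds 0) (nhds x) := by
    have : Continuous fun t : ℝ => x + t • v := by fun_prop
    simpa using this.tendsto 0
  set g : ℝ → ℝ := fun t => u (x + t • v) -
    ε * (Real.exp (-a * ‖(x - q) + t • v‖ ^ 2) - m) with hg
  have hgmin : IsLocalMin g 0 := by
    have h := hc.eventually hmin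
    filter_upwards [h] with t ht
    simpa [hg, add_sub_right_comm] using ht
  have hgd : ∀ᶠ t in nhds (0 : ℝ), HasDerivAt g (fderiv ℝ u (x + t • v) v -
      ε * (Real.exp (-a * ‖(x - q) + t • v‖ ^ 2) * (-a * (2 * inner ℝ ((x - q) + t • v) v)))) t := by
    filter_upwards [hu.eventually_hasDerivAt_line v] with t ht
    exact ht.sub (((hasDerivAt_exp_neg_sq_line a (x - q) v t).sub_const m).const_mul ε)
  have h1 := hgmin.hasDerivAt_eq_zero hgd.self_of_nhds
  have h2 := hgmin.nonneg_of_hasDerivAt_hasDerivAt hgd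
    ((hu.hasDerivAt_fderiv_line v).sub ((hasDerivAt_exp_neg_sq_line_deriv a (x - q) v).const_mul ε))
  simp only [zero_smul, add_zero] at h1
  constructor <;> linarith

open Metric in
/-- A zero set that accumulates at the boundary of the positivity set of a nonnegative function is
touched by a ball of positivity at exactly one point. -/
theorem exists_closedBall_touching_zero [FiniteDimensional ℝ E] {u : E → ℝ} {p : E} {r : ℝ}
    (hr : 0 < r) (hc : ContinuousOn u (closedBall p (2 * r)))
    (hnn : ∀ x ∈ closedBall p (2 * r), 0 ≤ u x) (hp : u p = 0)
    (hne : ∃ x ∈ ball p r, u x ≠ 0) :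
    ∃ q z R, 0 < R ∧ R < r ∧ z ∈ closedBall p (2 * r) ∧ dist z q = R ∧ u z = 0 ∧
      ∀ x ∈ closedBall q R, x ≠ z → 0 < u x := by
  obtain ⟨y, hy, huy⟩ := hne
  have hZc : IsCompact (closedBall p (2 * r) ∩ u ⁻¹' {0}) :=
    (isCompact_closedBall p (2 * r)).of_isClosed_subset
      (hc.preimage_isClosed_of_isClosed isClosed_closedBall isClosed_singleton)
      Set.inter_subset_left
  have hpZ : p ∈ closedBall p (2 * r) ∩ u ⁻¹' {0} :=
    ⟨mem_closedBall_self (by linarith), hp⟩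
  -- Take a zero `z` nearest to `y`. As `p` is a zero, `dist y z < r`, so the open ball about `y`
  -- through `z` stays inside the domain and is free of zeros.
  obtain ⟨z, hz, hzmin⟩ := hZc.exists_isMinOn ⟨p, hpZ⟩
    (f := fun z => dist y z) (by fun_prop)
  have hyz : 0 < dist y z := by
    refine dist_pos.2 fun h => huy ?_
    rw [h]; exact hz.2
  have hyp : dist y p < r := hy
  have hzp : dist y z ≤ dist y p := hzmin hpZ
  have hpos : ∀ x ∈ ball y (dist y z), 0 < u x := by
    intro x hx
    have hxy : dist x y < dist y z := hx
    have hxp : x ∈ closedBall p (2 * r) := by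
      have := dist_triangle x y p
      simp only [mem_closedBall]; linarith
    refine lt_of_le_of_ne (hnn x hxp) fun h => ?_
    have : dist y z ≤ dist y x := hzmin ⟨hxp, h.symm⟩
    rw [dist_comm y x] at this
    linarith
  -- The ball about `y` may meet the zero set at several boundary points. Halving it about the
  -- midpoint of `y` and `z` leaves a closed ball that touches the larger sphere only at `z`; the
  -- parallelogram law gives the strict inequality elsewhere.
  set w : E := (1 / 2 : ℝ) • (z - y) with hw
  have hwn : ‖w‖ = dist y z / 2 := by
    rw [hw, norm_smul, ← dist_eq_norm, dist_comm z y]; norm_num; ring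
  have hzw : z = y + w + w := by
    rw [hw, add_assoc, ← add_smul]; norm_num
  refine ⟨y + w, z, dist y z / 2, by linarith, by linarith, hz.1, ?_, hz.2, ?_⟩
  · rw [dist_eq_norm, ← hwn]; congr 1; rw [hzw]; abel
  · intro x hx hxz
    apply hpos
    rw [mem_closedBall, dist_eq_norm] at hx
    have hpar := parallelogram_law_with_norm ℝ (x - (y + w)) w
    have h1 : x - (y + w) + w = x - y := by abel
    have h2 : x - (y + w) - w = x - z := by rw [hzw]; abel
    rw [h1, h2, hwn] at hpar
    have hxz' : 0 < ‖x - z‖ := norm_pos_iff.2 (sub_ne_zero.2 hxz)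
    rw [mem_ball, dist_eq_norm]
    have h3 : ‖x - (y + w)‖ * ‖x - (y + w)‖ ≤ (dist y z / 2) * (dist y z / 2) :=
      mul_self_le_mul_self (norm_nonneg _) hx
    have h4 : 0 < ‖x - z‖ * ‖x - z‖ := mul_pos hxz' hxz'
    refine lt_of_mul_self_lt_mul_self₀ hyz.le ?_
    linarith

open Metric in
/-- Strong minimum principle (Hopf): a nonnegative supersolution of a linear second-order
elliptic operator without zeroth-order sign condition that vanishes at a point vanishes
near that point. The principal part is a sum of squares of vector fields. -/
theorem eventually_eq_zero_of_nonneg_supersolution [FiniteDimensional ℝ E]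
    {ι : Type*} [Fintype ι] {U : Set E} (hU : IsOpen U) {u : E → ℝ} (hu : ContDiffOn ℝ 2 u U)
    {V : ι → E → E} (hV : ∀ k, ContinuousOn (V k) U)
    (hspan : ∀ x ∈ U, ∀ d : E, d ≠ 0 → ∃ k, inner ℝ d (V k x) ≠ 0)
    {b : E → E} (hb : ContinuousOn b U) {c : E → ℝ} (hc : ContinuousOn c U)
    (hsup : ∀ x ∈ U, ∑ k, fderiv ℝ (fderiv ℝ u) x (V k x) (V k x) + fderiv ℝ u x (b x)
      + c x * u x ≤ 0)
    (hnn : ∀ x ∈ U, 0 ≤ u x) {p : E} (hp : p ∈ U) (hup : u p = 0) :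
    ∀ᶠ x in nhds p, u x = 0 := by
  by_contra hcon
  obtain ⟨r₀, hr₀, hr₀U⟩ := Metric.isOpen_iff.1 hU p hp
  -- With this choice both `closedBall p (2 * r)` and the ball of radius `R / 2 < r / 2` about the
  -- touching point remain inside `ball p r₀`.
  set r := r₀ / 4 with hr
  have hrpos : 0 < r := by positivity
  have hsub : closedBall p (2 * r) ⊆ U :=
    (closedBall_subset_ball (by rw [hr]; linarith)).trans hr₀U
  have hne : ∃ x ∈ ball p r, u x ≠ 0 := by
    by_contra! h
    exact hcon (Filter.mem_of_superset (ball_mem_nhds p hrpos) h)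
  obtain ⟨q, z, R, hR, hRr, hzp, hzq, huz, hpos⟩ := exists_closedBall_touching_zero hrpos
    (hu.continuousOn.mono hsub) (fun x hx => hnn x (hsub hx)) hup hne
  have hKU : closedBall z (R / 2) ⊆ U := by
    refine Set.Subset.trans (fun x hx => ?_) hr₀U
    have h1 : dist x z ≤ R / 2 := hx
    have h2 : dist z p ≤ 2 * r := hzp
    have h3 := dist_triangle x z p
    rw [mem_ball]
    linarith
  have hKc : IsCompact (closedBall z (R / 2)) := isCompact_closedBall _ _
  have hzK : z ∈ closedBall z (R / 2) := mem_closedBall_self (by linarith)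
  -- The radius `R / 2` keeps the centre `q` away, so the gradient of the barrier does not vanish
  -- and ellipticity bounds the principal part below.
  have hd : ∀ x ∈ closedBall z (R / 2), x - q ≠ 0 := by
    intro x hx h
    rw [sub_eq_zero.1 h] at hx
    have : dist q z ≤ R / 2 := hx
    rw [dist_comm, hzq] at this
    linarith
  have hVK : ∀ k, ContinuousOn (V k) (closedBall z (R / 2)) := fun k => (hV k).mono hKU
  have hbK := hb.mono hKU
  have hcK := hc.mono hKU
  -- bounds for the coefficients
  obtain ⟨a₀, ha₀, hA⟩ : ∃ a₀ > 0, ∀ x ∈ closedBall z (R / 2),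
      a₀ ≤ ∑ k, inner ℝ (x - q) (V k x) ^ 2 := by
    have hcont : ContinuousOn (fun x => ∑ k, inner ℝ (x - q) (V k x) ^ 2)
        (closedBall z (R / 2)) := by
      refine continuousOn_finsetSum _ fun k _ => ?_
      have := hVK k
      fun_prop
    obtain ⟨x₁, hx₁, hmin⟩ := hKc.exists_isMinOn ⟨z, hzK⟩ hcont
    refine ⟨_, ?_, fun x hx => hmin hx⟩
    obtain ⟨k, hk⟩ := hspan x₁ (hKU hx₁) _ (hd x₁ hx₁)
    exact Finset.sum_pos' (fun _ _ => sq_nonneg _) ⟨k, Finset.mem_univ k, by positivity⟩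
  obtain ⟨B₀, hB⟩ : ∃ B₀, ∀ x ∈ closedBall z (R / 2),
      ‖∑ k, ‖V k x‖ ^ 2 + inner ℝ (x - q) (b x)‖ ≤ B₀ := by
    refine hKc.exists_bound_of_continuousOn ?_
    refine ContinuousOn.add (continuousOn_finsetSum _ fun k _ => ?_) ?_
    · exact (hVK k).norm.pow 2
    · fun_prop
  obtain ⟨C₀, hC⟩ := hKc.exists_bound_of_continuousOn hcK
  have hB₀ : 0 ≤ B₀ := (norm_nonneg _).trans (hB z hzK)
  have hC₀ : 0 ≤ C₀ := (norm_nonneg _).trans (hC z hzK)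
  -- For large `a` the quadratic term `4 a² a₀` beats all lower-order terms; `1 ≤ a` allows `C₀ ≤ a
  -- * C₀`.
  obtain ⟨a, ha1, ha⟩ : ∃ a : ℝ, 1 ≤ a ∧ 2 * B₀ + C₀ < 4 * a * a₀ := by
    refine ⟨1 + (2 * B₀ + C₀) / (4 * a₀), by
      have : 0 ≤ (2 * B₀ + C₀) / (4 * a₀) := by positivity
      linarith, ?_⟩
    have : (2 * B₀ + C₀) / (4 * a₀) * (4 * a₀) = 2 * B₀ + C₀ := by field_simp
    nlinarith
  have hkey : 0 < 4 * a ^ 2 * a₀ - 2 * a * B₀ - C₀ := by nlinarith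
  -- the barrier
  set m := Real.exp (-a * R ^ 2) with hm
  have hexp1 : ∀ x, Real.exp (-a * ‖x - q‖ ^ 2) ≤ 1 := fun x => by
    rw [Real.exp_le_one_iff]
    have := mul_nonneg (by linarith : (0:ℝ) ≤ a) (sq_nonneg ‖x - q‖)
    linarith
  have hmpos : 0 < m := Real.exp_pos _
  have huK : ContinuousOn u (closedBall z (R / 2)) := hu.continuousOn.mono hKU
  -- On this compact set `u` is positive, since its only zero in the touching ball is `z`, the
  -- centre of the small sphere.
  obtain ⟨ε, hε, hεS⟩ : ∃ ε > 0, ∀ x ∈ sphere z (R / 2) ∩ closedBall q R, ε < u x := by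
    have hSc : IsCompact (sphere z (R / 2) ∩ closedBall q R) :=
      (isCompact_sphere z (R / 2)).inter_right isClosed_closedBall
    rcases (sphere z (R / 2) ∩ closedBall q R).eq_empty_or_nonempty with he | hne
    · exact ⟨1, one_pos, by simp [he]⟩
    · obtain ⟨x₁, hx₁, hmin⟩ := hSc.exists_isMinOn hne
        (huK.mono (Set.inter_subset_left.trans sphere_subset_closedBall))
      have : 0 < u x₁ := by
        refine hpos x₁ hx₁.2 fun h => ?_
        have := hx₁.1
        rw [h, mem_sphere, dist_self] at this
        linarith
      exact ⟨u x₁ / 2, by positivity, fun x hx => by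
        have : u x₁ ≤ u x := hmin hx
        linarith⟩
  set w : E → ℝ := fun y => u y - ε * (Real.exp (-a * ‖y - q‖ ^ 2) - m) with hw
  have hwz : w z = 0 := by
    simp [hw, huz, hm, ← dist_eq_norm, hzq]
  have hwS : ∀ x ∈ sphere z (R / 2), 0 < w x := by
    intro x hx
    by_cases hxq : x ∈ closedBall q R
    · have h1 := hεS x ⟨hx, hxq⟩
      have h2 : ε * (Real.exp (-a * ‖x - q‖ ^ 2) - m) ≤ ε * 1 :=
        mul_le_mul_of_nonneg_left (by linarith [hexp1 x]) hε.le
      simp only [hw]; linarith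
    · have h1 : R < ‖x - q‖ := by simpa [dist_eq_norm] using hxq
      have h2 : Real.exp (-a * ‖x - q‖ ^ 2) < m := by
        rw [hm, Real.exp_lt_exp]
        have : R ^ 2 < ‖x - q‖ ^ 2 := by gcongr
        nlinarith
      have h3 := hnn x (hKU (sphere_subset_closedBall hx))
      have h4 := mul_pos hε (sub_pos.2 h2)
      simp only [hw]; linarith
  -- As `w` is positive on the boundary sphere and zero at the centre `z`, its minimum is interior.
  -- There the derivatives of `u` are compared with those of the strict subsolution.
  obtain ⟨x, hxK, hxmin⟩ := hKc.exists_isMinOn ⟨z, hzK⟩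
    (show ContinuousOn w (closedBall z (R / 2)) by simp only [hw]; fun_prop)
  have hwx : w x ≤ 0 := by rw [← hwz]; exact hxmin hzK
  have hxball : x ∈ ball z (R / 2) := by
    rw [← ball_union_sphere] at hxK
    exact hxK.resolve_right fun h => absurd (hwS x h) (not_lt.2 hwx)
  have hloc : IsLocalMin w x :=
    hxmin.isLocalMin (Filter.mem_of_superset (isOpen_ball.mem_nhds hxball) ball_subset_closedBall)
  have hxU := hKU hxK
  have hder := derivatives_of_isLocalMin_sub_exp (hu.contDiffAt (hU.mem_nhds hxU)) hloc
  set e := Real.exp (-a * ‖x - q‖ ^ 2) with he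
  have hepos : 0 < e := Real.exp_pos _
  have hsum : ε * (e * (4 * a ^ 2 * ∑ k, inner ℝ (x - q) (V k x) ^ 2
      - 2 * a * ∑ k, ‖V k x‖ ^ 2)) ≤ ∑ k, fderiv ℝ (fderiv ℝ u) x (V k x) (V k x) := by
    rw [Finset.mul_sum, Finset.mul_sum, ← Finset.sum_sub_distrib, Finset.mul_sum, Finset.mul_sum]
    exact Finset.sum_le_sum fun k _ => (hder (V k x)).2
  have hfirst := (hder (b x)).1
  -- No sign of `c` is needed: `w x ≤ 0` gives `0 ≤ u x ≤ ε * e`, so the zeroth-order term is of the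
  -- size of the barrier.
  have hzeroth : -(C₀ * (ε * e)) ≤ c x * u x := by
    have h1 : u x ≤ ε * e := by
      have : u x - ε * (e - m) ≤ 0 := hwx
      nlinarith [mul_pos hε hmpos]
    have h2 := abs_le.1 (hC x hxK)
    have h3 := hnn x hxU
    nlinarith [mul_le_mul_of_nonneg_left h1 hC₀, mul_nonneg (by linarith : 0 ≤ c x + C₀) h3]
  have hsupx := hsup x hxU
  rw [hfirst] at hsupx
  have hBx := (abs_le.1 (hB x hxK)).2
  have hAx := hA x hxK
  set A := ∑ k, inner ℝ (x - q) (V k x) ^ 2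
  set T := ∑ k, ‖V k x‖ ^ 2
  set β := inner ℝ (x - q) (b x)
  have hfin : ε * e * (4 * a ^ 2 * A - 2 * a * (T + β) - C₀) ≤ 0 := by linarith
  have hεe : 0 < ε * e := mul_pos hε hepos
  have h1 : 4 * a ^ 2 * a₀ ≤ 4 * a ^ 2 * A := by gcongr
  have h2 : 2 * a * (T + β) ≤ 2 * a * B₀ := by gcongr
  have h3 : 0 < 4 * a ^ 2 * A - 2 * a * (T + β) - C₀ := by linarith
  exact absurd hfin (not_le.2 (mul_pos hεe h3))

end MaximumPrinciple

/-! ### Pointwise identities between the derivatives of an immersion and of its normal. -/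

section JetAlgebra

/-- The inner product of `ℝ³` in a frame given by two independent vectors and a common unit
normal. -/
theorem inner_eq_of_frame {a b n : E3} (hn : inner ℝ n n = 1) (han : inner ℝ a n = 0)
    (hbn : inner ℝ b n = 0)
    (hW : inner ℝ a a * inner ℝ b b - inner ℝ a b ^ 2 ≠ 0) (x y : E3) :
    (inner ℝ a a * inner ℝ b b - inner ℝ a b ^ 2) * inner ℝ x y =
      inner ℝ b b * inner ℝ x a * inner ℝ y a
      - inner ℝ a b * (inner ℝ x a * inner ℝ y b + inner ℝ x b * inner ℝ y a)
      + inner ℝ a a * inner ℝ x b * inner ℝ y b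
      + (inner ℝ a a * inner ℝ b b - inner ℝ a b ^ 2) * inner ℝ x n * inner ℝ y n := by
  have hba : inner ℝ b a = inner ℝ a b := real_inner_comm _ _
  have hna : inner ℝ n a = 0 := by rw [real_inner_comm]; exact han
  have hnb : inner ℝ n b = 0 := by rw [real_inner_comm]; exact hbn
  have hli : LinearIndependent ℝ ![a, b, n] := by
    rw [Fintype.linearIndependent_iff]
    intro g hg
    simp only [Fin.sum_univ_three, Matrix.cons_val_zero, Matrix.cons_val_one,
      Matrix.cons_val_two, Matrix.tail_cons, Matrix.head_cons] at hg
    have ha := congrArg (fun z => inner ℝ z a) hg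
    have hb := congrArg (fun z => inner ℝ z b) hg
    have hc := congrArg (fun z => inner ℝ z n) hg
    simp only [inner_add_left, real_inner_smul_left, inner_zero_left, hba, hna, hnb, han, hbn,
      hn, mul_zero, mul_one, add_zero, zero_add] at ha hb hc
    have h0 : g 0 = 0 := by
      have : (inner ℝ a a * inner ℝ b b - inner ℝ a b ^ 2) * g 0 = 0 := by
        linear_combination inner ℝ b b * ha - inner ℝ a b * hb
      exact (mul_eq_zero.1 this).resolve_left hW
    have h1 : g 1 = 0 := by
      have : (inner ℝ a a * inner ℝ b b - inner ℝ a b ^ 2) * g 1 = 0 := by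
        linear_combination inner ℝ a a * hb - inner ℝ a b * ha
      exact (mul_eq_zero.1 this).resolve_left hW
    intro i
    fin_cases i
    · exact h0
    · exact h1
    · exact hc
  have htop := hli.span_eq_top_of_card_eq_finrank (by simp)
  set W := inner ℝ a a * inner ℝ b b - inner ℝ a b ^ 2 with hWdef
  -- `z` is `W • x` minus its expansion in the frame, with coefficients from Cramer's rule. It is
  -- orthogonal to the spanning vectors `a`, `b`, `n`, hence to everything.
  set z : E3 := W • x - (inner ℝ b b * inner ℝ x a - inner ℝ a b * inner ℝ x b) • a
    - (inner ℝ a a * inner ℝ x b - inner ℝ a b * inner ℝ x a) • b - (W * inner ℝ x n) • n with hz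
  have hza : inner ℝ z a = 0 := by
    simp only [hz, inner_sub_left, real_inner_smul_left, hba, hna, hWdef]; ring
  have hzb : inner ℝ z b = 0 := by
    simp only [hz, inner_sub_left, real_inner_smul_left, hnb, hWdef]; ring
  have hzn : inner ℝ z n = 0 := by
    simp only [hz, inner_sub_left, real_inner_smul_left, han, hbn, hn]; ring
  have hz0 : ∀ y, inner ℝ z y = 0 := by
    intro y
    have hy : y ∈ Submodule.span ℝ (Set.range ![a, b, n]) := by rw [htop]; trivial
    induction hy using Submodule.span_induction with
    | mem v hv =>
      obtain ⟨i, rfl⟩ := hv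
      fin_cases i
      · exact hza
      · exact hzb
      · exact hzn
    | zero => exact inner_zero_right _
    | add u v _ _ hu hv => rw [inner_add_right, hu, hv, add_zero]
    | smul t v _ hv => rw [inner_smul_right, hv, mul_zero]
  have := hz0 y
  simp only [hz, inner_sub_left, real_inner_smul_left] at this
  rw [real_inner_comm y a, real_inner_comm y b, real_inner_comm y n] at this
  rw [real_inner_comm a y, real_inner_comm b y, real_inner_comm n y]
  simp only [real_inner_comm] at this ⊢
  linear_combination this

/-- Contracted Codazzi equation in terms of the entries of the fundamental forms, their
derivatives in one coordinate direction, and the mixed products. The unknowns `nᵢFⱼₗ` are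
`⟨∂ᵢn, ∂ⱼ∂ₗF⟩`, expressed by the Weingarten equations. -/
theorem contracted_codazzi
    {E F G W h11 h12 h22 γ1 γ2 δ1 δ2 s11 s12 s21 s22 t12 t22 n1a n2a n1b n2b n1c V Q dQ dW : ℝ}
    (hWdef : W = E * G - F ^ 2) (hQ : Q = G * h11 - 2 * F * h12 + E * h22)
    (hdW : dW = 2 * γ1 * G + E * (2 * δ2) - 2 * F * (γ2 + δ1))
    (hV : V = G * n1a - 2 * F * n1b + E * n1c)
    (w1a : W * n1a = G * h11 * γ1 - F * (h11 * γ2 + h12 * γ1) + E * h12 * γ2)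
    (w2a : W * n2a = G * h12 * γ1 - F * (h12 * γ2 + h22 * γ1) + E * h22 * γ2)
    (w1b : W * n1b = G * h11 * δ1 - F * (h11 * δ2 + h12 * δ1) + E * h12 * δ2)
    (w2b : W * n2b = G * h12 * δ1 - F * (h12 * δ2 + h22 * δ1) + E * h22 * δ2)
    (hdQ : dQ = 2 * δ2 * h11 + G * (s11 + n1a) - 2 * (γ2 + δ1) * h12
      - F * (s12 + n1b + s21 + n2a) + 2 * γ1 * h22 + E * (s22 + n2b))
    (c1 : s12 + n1b = s21 + n2a) (c2 : s22 + n1c = t22 + n2b) (ht : t12 = s21) :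
    W * (G * s11 - 2 * F * t12 + E * t22) = W * dQ - Q * dW + W * V := by
  subst hQ hdW hV hdQ ht
  -- The Codazzi relations `c1`, `c2` trade the mixed terms of `dQ` for those on the left; the
  -- Weingarten relations remove the products of first derivatives of the normal with second
  -- derivatives of the immersion.
  linear_combination F * W * c1 - E * W * c2 - 2 * G * w1a + 2 * F * w2a - 2 * E * w2b
    + 2 * F * w1b - (2 * δ2 * h11 - 2 * (γ2 + δ1) * h12 + 2 * γ1 * h22) * hWdef

/-- The elliptic equation for the component `⟨n, e⟩` of the unit normal of an immersion
`F : ℝ² → ℝ³` whose mean curvature is `-ψ ⟨n, e⟩`, as an identity between jets at a point. The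
vectors `a, b` are the first derivatives of `F`, the vectors `aa, ab, bb` the second ones, and
likewise for the derivatives `na, nb, naa, nab, nbb` of `n`; `ψ' * ⟨a, e⟩` and `ψ' * ⟨b, e⟩` are
the derivatives of `ψ`. -/
theorem normal_component_jet_equation
    {a b aa ab bb n na nb naa nab nbb e : E3} {ψ ψ' E F G W : ℝ}
    (hE : E = inner ℝ a a) (hF : F = inner ℝ a b) (hG : G = inner ℝ b b)
    (hW : W = E * G - F ^ 2) (hW0 : W ≠ 0)
    (hn : inner ℝ n n = 1) (han : inner ℝ a n = 0) (hbn : inner ℝ b n = 0)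
    (hna : inner ℝ na n = 0) (hnb : inner ℝ nb n = 0)
    (hnaa : inner ℝ naa n = -inner ℝ na na) (hnab : inner ℝ nab n = -inner ℝ na nb)
    (hnbb : inner ℝ nbb n = -inner ℝ nb nb)
    (hsym : inner ℝ na b = inner ℝ nb a)
    (ca : inner ℝ naa b + inner ℝ na ab = inner ℝ nab a + inner ℝ nb aa)
    (cb : inner ℝ nab b + inner ℝ na bb = inner ℝ nbb a + inner ℝ nb ab)
    (hQ : G * inner ℝ na a - 2 * F * inner ℝ na b + E * inner ℝ nb b = -(W * ψ * inner ℝ n e))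
    (hQa : 2 * inner ℝ ab b * inner ℝ na a + G * (inner ℝ naa a + inner ℝ na aa)
      - 2 * (inner ℝ aa b + inner ℝ ab a) * inner ℝ na b
      - F * (inner ℝ naa b + inner ℝ na ab + inner ℝ nab a + inner ℝ nb aa)
      + 2 * inner ℝ aa a * inner ℝ nb b + E * (inner ℝ nab b + inner ℝ nb ab)
      = -((2 * inner ℝ aa a * G + E * (2 * inner ℝ ab b) - 2 * F * (inner ℝ aa b + inner ℝ ab a))
        * ψ * inner ℝ n e + W * (ψ' * inner ℝ a e) * inner ℝ n e + W * ψ * inner ℝ na e))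
    (hQb : 2 * inner ℝ ab a * inner ℝ nb b + E * (inner ℝ nbb b + inner ℝ nb bb)
      - 2 * (inner ℝ bb a + inner ℝ ab b) * inner ℝ na b
      - F * (inner ℝ nbb a + inner ℝ nb ab + inner ℝ nab b + inner ℝ na bb)
      + 2 * inner ℝ bb b * inner ℝ na a + G * (inner ℝ nab a + inner ℝ na ab)
      = -((2 * inner ℝ bb b * E + G * (2 * inner ℝ ab a) - 2 * F * (inner ℝ bb a + inner ℝ ab b))
        * ψ * inner ℝ n e + W * (ψ' * inner ℝ b e) * inner ℝ n e + W * ψ * inner ℝ nb e)) :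
    (G * inner ℝ naa e - 2 * F * inner ℝ nab e + E * inner ℝ nbb e)
      + (W⁻¹ * (W * ψ * (G * inner ℝ a e - F * inner ℝ b e)
          - (G * inner ℝ (G • aa - (2 * F) • ab + E • bb) a
            - F * inner ℝ (G • aa - (2 * F) • ab + E • bb) b)) * inner ℝ na e
        + W⁻¹ * (W * ψ * (E * inner ℝ b e - F * inner ℝ a e)
          - (E * inner ℝ (G • aa - (2 * F) • ab + E • bb) b
            - F * inner ℝ (G • aa - (2 * F) • ab + E • bb) a)) * inner ℝ nb e)
      + (ψ' * (G * inner ℝ a e ^ 2 - 2 * F * inner ℝ a e * inner ℝ b e + E * inner ℝ b e ^ 2)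
          + (G * inner ℝ na na - 2 * F * inner ℝ na nb + E * inner ℝ nb nb)) * inner ℝ n e = 0 := by
  have hfr : ∀ x y, W * inner ℝ x y = G * inner ℝ x a * inner ℝ y a
      - F * (inner ℝ x a * inner ℝ y b + inner ℝ x b * inner ℝ y a)
      + E * inner ℝ x b * inner ℝ y b + W * inner ℝ x n * inner ℝ y n := by
    subst hE hF hG hW
    exact inner_eq_of_frame hn han hbn hW0
  have hfr0 : ∀ x y, inner ℝ x n = 0 → W * inner ℝ x y = G * inner ℝ x a * inner ℝ y a
      - F * (inner ℝ x a * inner ℝ y b + inner ℝ x b * inner ℝ y a)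
      + E * inner ℝ x b * inner ℝ y b := by
    intro x y hx
    rw [hfr x y, hx]; ring
  -- `D` is the principal operator applied to `n`. Its tangential components come from the
  -- derivative of the mean curvature, its normal one from `⟨n, n⟩ = 1`; pairing with `e` through
  -- the frame then gives the equation. The tangential part of `V` enters the drift.
  set D : E3 := G • naa - (2 * F) • nab + E • nbb with hD
  set V : E3 := G • aa - (2 * F) • ab + E • bb with hV
  have hDin : ∀ y, inner ℝ D y = G * inner ℝ naa y - 2 * F * inner ℝ nab y + E * inner ℝ nbb y := by
    intro y
    simp only [hD, inner_add_left, inner_sub_left, real_inner_smul_left]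
  have hVin : ∀ y, inner ℝ y V = G * inner ℝ y aa - 2 * F * inner ℝ y ab + E * inner ℝ y bb := by
    intro y
    simp only [hV, inner_add_right, inner_sub_right, real_inner_smul_right]
  have hDa := contracted_codazzi (t12 := inner ℝ nab a) hW hQ.symm rfl (hVin na)
    (hfr0 na aa hna) (by rw [hfr0 nb aa hnb, hsym]) (hfr0 na ab hna)
    (by rw [hfr0 nb ab hnb, hsym]) hQa.symm ca cb rfl
  -- The same identity with the two coordinates exchanged.
  have hDb := contracted_codazzi (E := G) (F := F) (G := E) (W := W) (h11 := inner ℝ nb b)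
    (h12 := inner ℝ na b) (h22 := inner ℝ na a) (t12 := inner ℝ nab b) (t22 := inner ℝ naa b)
    (V := inner ℝ nb V) (Q := -(W * ψ * inner ℝ n e)) (s12 := inner ℝ nbb a) (s21 := inner ℝ nab b) (n1c := inner ℝ nb aa)
    (by rw [hW]; ring) (by rw [← hQ]; ring) rfl (by rw [hVin]; ring)
    (by rw [hfr0 nb bb hnb, hsym]; ring) (by rw [hfr0 na bb hna]; ring)
    (by rw [hfr0 nb ab hnb, hsym]; ring) (by rw [hfr0 na ab hna]; ring)
    hQb.symm (by linarith) (by linarith) rfl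
  have hDe := hfr D e
  have hVa := hfr0 na V hna
  have hVb := hfr0 nb V hnb
  have hea := hfr0 na e hna
  have heb := hfr0 nb e hnb
  have hDn : inner ℝ D n = -(G * inner ℝ na na - 2 * F * inner ℝ na nb + E * inner ℝ nb nb) := by
    rw [hDin, hnaa, hnab, hnbb]; ring
  rw [← hDin]
  have hDa' : W * inner ℝ D a = -(W ^ 2 * (ψ' * inner ℝ a e * inner ℝ n e + ψ * inner ℝ na e))
      + W * inner ℝ na V := by
    rw [hDin]; linear_combination hDa
  have hDb' : W * inner ℝ D b = -(W ^ 2 * (ψ' * inner ℝ b e * inner ℝ n e + ψ * inner ℝ nb e))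
      + W * inner ℝ nb V := by
    rw [hDin]; linear_combination hDb
  rw [real_inner_comm a e, real_inner_comm b e, real_inner_comm n e] at hDe
  rw [real_inner_comm a e, real_inner_comm b e] at hea
  rw [real_inner_comm a e, real_inner_comm b e, ← hsym] at heb
  rw [← hsym] at hVb
  have hWW : W * W⁻¹ = 1 := mul_inv_cancel₀ hW0
  -- One factor `W` comes from expanding `D` in the frame, the other from its components `⟨D, a⟩`
  -- and `⟨D, b⟩`, known only after multiplication by `W`.
  refine (mul_eq_zero.1 (?_ : W ^ 2 * _ = 0)).resolve_left (pow_ne_zero 2 hW0)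
  set μ := inner ℝ a e
  set ν := inner ℝ b e
  set S₁ := W * ψ * (G * μ - F * ν) - (G * inner ℝ V a - F * inner ℝ V b)
  set S₂ := W * ψ * (E * ν - F * μ) - (E * inner ℝ V b - F * inner ℝ V a)
  linear_combination W * hDe + (G * μ - F * ν) * hDa' + (E * ν - F * μ) * hDb'
    + (G * μ - F * ν) * hVa + (E * ν - F * μ) * hVb
    - (G * inner ℝ V a - F * inner ℝ V b) * hea - (E * inner ℝ V b - F * inner ℝ V a) * heb
    + W ^ 2 * inner ℝ n e * hDn + W * (S₁ * inner ℝ na e + S₂ * inner ℝ nb e) * hWW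

end JetAlgebra

theorem two_le_smooth : (2 : WithTop ℕ∞) ≤ ∞ := ENat.LEInfty.out

/-! ### Calculus of partial derivatives on the coordinate plane. -/

section CoordDeriv

variable {V : Type*} [NormedAddCommGroup V]

/-- The partial derivative of a map on the coordinate plane. -/
noncomputable def coordDeriv [NormedSpace ℝ V] (i : Fin 2) (k : EuclideanSpace ℝ (Fin 2) → V) :
    EuclideanSpace ℝ (Fin 2) → V :=
  fun x => fderiv ℝ k x (coordVec i)

variable {U : Set (EuclideanSpace ℝ (Fin 2))} {x : EuclideanSpace ℝ (Fin 2)}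

theorem ContDiffOn.coordDeriv [NormedSpace ℝ V] {k : EuclideanSpace ℝ (Fin 2) → V}
    (hU : IsOpen U) (hk : ContDiffOn ℝ ∞ k U) (i : Fin 2) :
    ContDiffOn ℝ ∞ (coordDeriv i k) U :=
  (hk.fderiv_of_isOpen hU (m := ∞) (by simp)).clm_apply contDiffOn_const

theorem coordDeriv_congr [NormedSpace ℝ V] {k l : EuclideanSpace ℝ (Fin 2) → V} (hU : IsOpen U)
    (hx : x ∈ U) (h : ∀ y ∈ U, k y = l y) (i : Fin 2) : coordDeriv i k x = coordDeriv i l x := by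
  have : k =ᶠ[nhds x] l := Filter.mem_of_superset (hU.mem_nhds hx) h
  simp only [coordDeriv, this.fderiv_eq]

theorem coordDeriv_coordDeriv [NormedSpace ℝ V] {k : EuclideanSpace ℝ (Fin 2) → V} (hU : IsOpen U)
    (hk : ContDiffOn ℝ ∞ k U) (hx : x ∈ U) (i j : Fin 2) :
    coordDeriv i (coordDeriv j k) x = fderiv ℝ (fderiv ℝ k) x (coordVec i) (coordVec j) := by
  have hd : DifferentiableAt ℝ (fderiv ℝ k) x :=
    ((hk.fderiv_of_isOpen hU (m := 1) (by norm_num [two_le_smooth])).contDiffAt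
      (hU.mem_nhds hx)).differentiableAt (by simp)
  change fderiv ℝ (fun y => fderiv ℝ k y (coordVec j)) x (coordVec i) = _
  rw [fderiv_clm_apply hd (differentiableAt_const _)]
  simp

theorem coordDeriv_comm [NormedSpace ℝ V] {k : EuclideanSpace ℝ (Fin 2) → V} (hU : IsOpen U)
    (hk : ContDiffOn ℝ ∞ k U) (hx : x ∈ U) (i j : Fin 2) :
    coordDeriv i (coordDeriv j k) x = coordDeriv j (coordDeriv i k) x := by
  rw [coordDeriv_coordDeriv hU hk hx, coordDeriv_coordDeriv hU hk hx]
  exact ((hk.contDiffAt (hU.mem_nhds hx)).isSymmSndFDerivAt (by simpa using two_le_smooth)) _ _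

theorem coordDeriv_inner [InnerProductSpace ℝ V] {k l : EuclideanSpace ℝ (Fin 2) → V}
    (hU : IsOpen U) (hk : ContDiffOn ℝ ∞ k U) (hl : ContDiffOn ℝ ∞ l U) (hx : x ∈ U) (i : Fin 2) :
    coordDeriv i (fun y => inner ℝ (k y) (l y)) x =
      inner ℝ (coordDeriv i k x) (l x) + inner ℝ (k x) (coordDeriv i l x) := by
  have h1 := (hk.contDiffAt (hU.mem_nhds hx)).differentiableAt (by simp)
  have h2 := (hl.contDiffAt (hU.mem_nhds hx)).differentiableAt (by simp)
  simp only [coordDeriv]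
  rw [fderiv_inner_apply ℝ h1 h2]
  ring

theorem coordDeriv_mul {k l : EuclideanSpace ℝ (Fin 2) → ℝ}
    (hU : IsOpen U) (hk : ContDiffOn ℝ ∞ k U) (hl : ContDiffOn ℝ ∞ l U) (hx : x ∈ U) (i : Fin 2) :
    coordDeriv i (fun y => k y * l y) x = coordDeriv i k x * l x + k x * coordDeriv i l x := by
  have h1 := (hk.contDiffAt (hU.mem_nhds hx)).differentiableAt (by simp)
  have h2 := (hl.contDiffAt (hU.mem_nhds hx)).differentiableAt (by simp)
  simp only [coordDeriv]
  rw [fderiv_fun_mul h1 h2]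
  simp
  ring

theorem coordDeriv_add {k l : EuclideanSpace ℝ (Fin 2) → ℝ}
    (hU : IsOpen U) (hk : ContDiffOn ℝ ∞ k U) (hl : ContDiffOn ℝ ∞ l U) (hx : x ∈ U) (i : Fin 2) :
    coordDeriv i (fun y => k y + l y) x = coordDeriv i k x + coordDeriv i l x := by
  have h1 := (hk.contDiffAt (hU.mem_nhds hx)).differentiableAt (by simp)
  have h2 := (hl.contDiffAt (hU.mem_nhds hx)).differentiableAt (by simp)
  simp only [coordDeriv]
  rw [fderiv_fun_add h1 h2]
  simp

theorem coordDeriv_sub {k l : EuclideanSpace ℝ (Fin 2) → ℝ}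
    (hU : IsOpen U) (hk : ContDiffOn ℝ ∞ k U) (hl : ContDiffOn ℝ ∞ l U) (hx : x ∈ U) (i : Fin 2) :
    coordDeriv i (fun y => k y - l y) x = coordDeriv i k x - coordDeriv i l x := by
  have h1 := (hk.contDiffAt (hU.mem_nhds hx)).differentiableAt (by simp)
  have h2 := (hl.contDiffAt (hU.mem_nhds hx)).differentiableAt (by simp)
  simp only [coordDeriv]
  rw [fderiv_fun_sub h1 h2]
  simp

theorem coordDeriv_const (c : ℝ) (i : Fin 2) :
    coordDeriv i (fun _ => c) x = 0 := by
  simp [coordDeriv]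

end CoordDeriv

/-! ### The elliptic equation for the angle function on a coordinate patch. -/

section Patch

variable {U : Set (EuclideanSpace ℝ (Fin 2))} {X n : EuclideanSpace ℝ (Fin 2) → E3}
  {ψ ψ' : EuclideanSpace ℝ (Fin 2) → ℝ} {e : E3}

theorem inner_coordDeriv_normal_self (hU : IsOpen U) (hn : ContDiffOn ℝ ∞ n U)
    (hunit : ∀ x ∈ U, inner ℝ (n x) (n x) = 1) {x : EuclideanSpace ℝ (Fin 2)} (hx : x ∈ U)
    (i : Fin 2) : inner ℝ (coordDeriv i n x) (n x) = 0 := by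
  have := coordDeriv_congr hU hx hunit i
  rw [coordDeriv_inner hU hn hn hx, coordDeriv_const, real_inner_comm (coordDeriv i n x)] at this
  linarith

/-- Symmetry of the second fundamental form on a coordinate patch. -/
theorem inner_coordDeriv_normal_symm (hU : IsOpen U) (hX : ContDiffOn ℝ ∞ X U)
    (hn : ContDiffOn ℝ ∞ n U) (hnormal : ∀ x ∈ U, ∀ i, inner ℝ (coordDeriv i X x) (n x) = 0)
    {x : EuclideanSpace ℝ (Fin 2)} (hx : x ∈ U) (i j : Fin 2) :
    inner ℝ (coordDeriv i n x) (coordDeriv j X x)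
      = inner ℝ (coordDeriv j n x) (coordDeriv i X x) := by
  have h1 := coordDeriv_congr hU hx (fun y hy => hnormal y hy j) i
  have h2 := coordDeriv_congr hU hx (fun y hy => hnormal y hy i) j
  rw [coordDeriv_inner hU (hX.coordDeriv hU j) hn hx, coordDeriv_const] at h1
  rw [coordDeriv_inner hU (hX.coordDeriv hU i) hn hx, coordDeriv_const,
    coordDeriv_comm hU hX hx] at h2
  rw [real_inner_comm, real_inner_comm (coordDeriv i X x)]
  linarith

/-- The elliptic equation satisfied on a coordinate patch by the component `⟨n, e⟩` of the unit
normal, when the mean curvature is `-ψ ⟨n, e⟩` and the differential of `ψ` is a multiple of that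
of `⟨X, e⟩`. -/
theorem normal_component_patch_equation (hU : IsOpen U) (hX : ContDiffOn ℝ ∞ X U)
    (hn : ContDiffOn ℝ ∞ n U) (hψ : ContDiffOn ℝ ∞ ψ U)
    (hdψ : ∀ x ∈ U, ∀ i, coordDeriv i ψ x = ψ' x * inner ℝ (coordDeriv i X x) e)
    (hunit : ∀ x ∈ U, inner ℝ (n x) (n x) = 1)
    (hnormal : ∀ x ∈ U, ∀ i, inner ℝ (coordDeriv i X x) (n x) = 0)
    {a b aa ab bb na nb naa nab nbb : EuclideanSpace ℝ (Fin 2) → E3}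
    {E F G W : EuclideanSpace ℝ (Fin 2) → ℝ}
    (ha : a = coordDeriv 0 X) (hb : b = coordDeriv 1 X) (haa : aa = coordDeriv 0 a)
    (hab : ab = coordDeriv 0 b) (hbb : bb = coordDeriv 1 b)
    (hna : na = coordDeriv 0 n) (hnb : nb = coordDeriv 1 n) (hnaa : naa = coordDeriv 0 na)
    (hnab : nab = coordDeriv 0 nb) (hnbb : nbb = coordDeriv 1 nb)
    (hE : E = fun x => inner ℝ (a x) (a x)) (hF : F = fun x => inner ℝ (a x) (b x))
    (hG : G = fun x => inner ℝ (b x) (b x)) (hW : W = fun x => E x * G x - F x * F x)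
    (hW0 : ∀ x ∈ U, W x ≠ 0)
    (hmean : ∀ x ∈ U, G x * inner ℝ (na x) (a x) - 2 * F x * inner ℝ (na x) (b x)
      + E x * inner ℝ (nb x) (b x) = -(W x * ψ x * inner ℝ (n x) e))
    {x : EuclideanSpace ℝ (Fin 2)} (hx : x ∈ U) :
    (G x * inner ℝ (naa x) e - 2 * F x * inner ℝ (nab x) e + E x * inner ℝ (nbb x) e)
      + ((W x)⁻¹ * (W x * ψ x * (G x * inner ℝ (a x) e - F x * inner ℝ (b x) e)
          - (G x * inner ℝ (G x • aa x - (2 * F x) • ab x + E x • bb x) (a x)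
            - F x * inner ℝ (G x • aa x - (2 * F x) • ab x + E x • bb x) (b x)))
              * inner ℝ (na x) e
        + (W x)⁻¹ * (W x * ψ x * (E x * inner ℝ (b x) e - F x * inner ℝ (a x) e)
          - (E x * inner ℝ (G x • aa x - (2 * F x) • ab x + E x • bb x) (b x)
            - F x * inner ℝ (G x • aa x - (2 * F x) • ab x + E x • bb x) (a x)))
              * inner ℝ (nb x) e)
      + (ψ' x * (G x * inner ℝ (a x) e ^ 2 - 2 * F x * inner ℝ (a x) e * inner ℝ (b x) e
            + E x * inner ℝ (b x) e ^ 2)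
          + (G x * inner ℝ (na x) (na x) - 2 * F x * inner ℝ (na x) (nb x)
            + E x * inner ℝ (nb x) (nb x))) * inner ℝ (n x) e = 0 := by
  have sa : ContDiffOn ℝ ∞ a U := ha ▸ hX.coordDeriv hU 0
  have sb : ContDiffOn ℝ ∞ b U := hb ▸ hX.coordDeriv hU 1
  have sna : ContDiffOn ℝ ∞ na U := hna ▸ hn.coordDeriv hU 0
  have snb : ContDiffOn ℝ ∞ nb U := hnb ▸ hn.coordDeriv hU 1
  have hab' : ∀ y ∈ U, coordDeriv 1 a y = ab y := fun y hy => by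
    rw [ha, hab, hb, coordDeriv_comm hU hX hy]
  have hnab' : ∀ y ∈ U, coordDeriv 1 na y = nab y := fun y hy => by
    rw [hna, hnab, hnb, coordDeriv_comm hU hn hy]
  have sE : ContDiffOn ℝ ∞ E U := hE ▸ sa.inner ℝ sa
  have sF : ContDiffOn ℝ ∞ F U := hF ▸ sa.inner ℝ sb
  have sG : ContDiffOn ℝ ∞ G U := hG ▸ sb.inner ℝ sb
  have sW : ContDiffOn ℝ ∞ W U := hW ▸ (sE.mul sG).sub (sF.mul sF)
  have han : ∀ y ∈ U, inner ℝ (a y) (n y) = 0 := fun y hy => by rw [ha]; exact hnormal y hy 0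
  have hbn : ∀ y ∈ U, inner ℝ (b y) (n y) = 0 := fun y hy => by rw [hb]; exact hnormal y hy 1
  have hnan : ∀ y ∈ U, inner ℝ (na y) (n y) = 0 := fun y hy => by
    rw [hna]; exact inner_coordDeriv_normal_self hU hn hunit hy 0
  have hnbn : ∀ y ∈ U, inner ℝ (nb y) (n y) = 0 := fun y hy => by
    rw [hnb]; exact inner_coordDeriv_normal_self hU hn hunit hy 1
  have hnaan : inner ℝ (naa x) (n x) = -inner ℝ (na x) (na x) := by
    have := coordDeriv_congr hU hx hnan 0
    rw [coordDeriv_inner hU sna hn hx, coordDeriv_const, ← hna, ← hnaa] at this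
    linarith
  have hnabn : inner ℝ (nab x) (n x) = -inner ℝ (na x) (nb x) := by
    have := coordDeriv_congr hU hx hnan 1
    rw [coordDeriv_inner hU sna hn hx, coordDeriv_const, ← hnb, hnab' x hx] at this
    linarith
  have hnbbn : inner ℝ (nbb x) (n x) = -inner ℝ (nb x) (nb x) := by
    have := coordDeriv_congr hU hx hnbn 1
    rw [coordDeriv_inner hU snb hn hx, coordDeriv_const, ← hnb, ← hnbb] at this
    linarith
  have hsym : ∀ y ∈ U, inner ℝ (na y) (b y) = inner ℝ (nb y) (a y) := fun y hy => by
    rw [hna, hnb, ha, hb]; exact inner_coordDeriv_normal_symm hU hX hn hnormal hy 0 1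
  -- The Codazzi equations are the derivatives of the symmetry of the second fundamental form; in
  -- this form no third derivative of `X` occurs.
  have ca : inner ℝ (naa x) (b x) + inner ℝ (na x) (ab x)
      = inner ℝ (nab x) (a x) + inner ℝ (nb x) (aa x) := by
    have := coordDeriv_congr hU hx hsym 0
    rwa [coordDeriv_inner hU sna sb hx, coordDeriv_inner hU snb sa hx, ← hnaa, ← hab, ← hnab,
      ← haa] at this
  have cb : inner ℝ (nab x) (b x) + inner ℝ (na x) (bb x)
      = inner ℝ (nbb x) (a x) + inner ℝ (nb x) (ab x) := by
    have := coordDeriv_congr hU hx hsym 1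
    rwa [coordDeriv_inner hU sna sb hx, coordDeriv_inner hU snb sa hx, hnab' x hx, ← hbb, ← hnbb,
      hab' x hx] at this
  have hQ : ∀ i, coordDeriv i (fun y => G y * inner ℝ (na y) (a y)
      - (2 * F y) * inner ℝ (na y) (b y) + E y * inner ℝ (nb y) (b y)) x =
      coordDeriv i (fun y => (-1) * (W y * ψ y * inner ℝ (n y) e)) x := fun i =>
    coordDeriv_congr hU hx (fun y hy => by rw [hmean y hy]; ring) i
  have se : ContDiffOn ℝ ∞ (fun _ => e) U := contDiffOn_const
  have hexp : ∀ i, coordDeriv i (fun y => G y * inner ℝ (na y) (a y)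
      - (2 * F y) * inner ℝ (na y) (b y) + E y * inner ℝ (nb y) (b y)) x =
      coordDeriv i G x * inner ℝ (na x) (a x) + G x * (inner ℝ (coordDeriv i na x) (a x)
        + inner ℝ (na x) (coordDeriv i a x))
      - (2 * coordDeriv i F x * inner ℝ (na x) (b x) + 2 * F x * (inner ℝ (coordDeriv i na x) (b x)
        + inner ℝ (na x) (coordDeriv i b x)))
      + (coordDeriv i E x * inner ℝ (nb x) (b x) + E x * (inner ℝ (coordDeriv i nb x) (b x)
        + inner ℝ (nb x) (coordDeriv i b x))) := fun i => by
    have s2F : ContDiffOn ℝ ∞ (fun y => 2 * F y) U := contDiffOn_const.mul sF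
    rw [coordDeriv_add hU ((sG.mul (sna.inner ℝ sa)).sub (s2F.mul (sna.inner ℝ sb)))
        (sE.mul (snb.inner ℝ sb)) hx,
      coordDeriv_sub hU (sG.mul (sna.inner ℝ sa)) (s2F.mul (sna.inner ℝ sb)) hx,
      coordDeriv_mul hU sG (sna.inner ℝ sa) hx, coordDeriv_mul hU s2F (sna.inner ℝ sb) hx,
      coordDeriv_mul hU sE (snb.inner ℝ sb) hx, coordDeriv_mul hU contDiffOn_const sF hx,
      coordDeriv_const, coordDeriv_inner hU sna sa hx, coordDeriv_inner hU sna sb hx,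
      coordDeriv_inner hU snb sb hx]
    ring
  have hexp' : ∀ i, coordDeriv i (fun y => (-1) * (W y * ψ y * inner ℝ (n y) e)) x =
      -((coordDeriv i W x * ψ x + W x * (ψ' x * inner ℝ (coordDeriv i X x) e)) * inner ℝ (n x) e
        + W x * ψ x * inner ℝ (coordDeriv i n x) e) := fun i => by
    rw [coordDeriv_mul hU contDiffOn_const ((sW.mul hψ).mul (hn.inner ℝ se)) hx, coordDeriv_const,
      coordDeriv_mul hU (sW.mul hψ) (hn.inner ℝ se) hx, coordDeriv_mul hU sW hψ hx, hdψ x hx,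
      coordDeriv_inner hU hn se hx]
    have : coordDeriv i (fun _ => e) x = 0 := by simp [coordDeriv]
    rw [this, inner_zero_right]
    ring
  have dW : ∀ i, coordDeriv i W x = coordDeriv i E x * G x + E x * coordDeriv i G x
      - 2 * (F x * coordDeriv i F x) := fun i => by
    rw [hW, coordDeriv_sub hU (sE.mul sG) (sF.mul sF) hx, coordDeriv_mul hU sE sG hx,
      coordDeriv_mul hU sF sF hx]
    ring
  have dE : ∀ i, coordDeriv i E x = 2 * inner ℝ (coordDeriv i a x) (a x) := fun i => by
    rw [hE, coordDeriv_inner hU sa sa hx, real_inner_comm (coordDeriv i a x)]; ring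
  have dG : ∀ i, coordDeriv i G x = 2 * inner ℝ (coordDeriv i b x) (b x) := fun i => by
    rw [hG, coordDeriv_inner hU sb sb hx, real_inner_comm (coordDeriv i b x)]; ring
  have dF : ∀ i, coordDeriv i F x = inner ℝ (coordDeriv i a x) (b x)
      + inner ℝ (coordDeriv i b x) (a x) := fun i => by
    rw [hF, coordDeriv_inner hU sa sb hx, real_inner_comm (coordDeriv i b x)]
  have hQa := hQ 0
  have hQb := hQ 1
  rw [hexp, hexp', dW, dE, dF, dG, ← ha, ← haa, ← hab, ← hna, ← hnaa, ← hnab] at hQa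
  rw [hexp, hexp', dW, dE, dF, dG, ← hb, hab' x hx, ← hbb, ← hnb, hnab' x hx, ← hnbb] at hQb
  refine normal_component_jet_equation (by rw [hE]) (by rw [hF]) (by rw [hG])
    (by rw [hW]; ring) (hW0 x hx) (hunit x hx) (han x hx) (hbn x hx) (hnan x hx) (hnbn x hx)
    hnaan hnabn hnbbn (hsym x hx) ca cb (hmean x hx) ?_ ?_
  -- Differentiation gives twice one side of the Codazzi equation, whereas the jet identity is
  -- written with the sum of both sides.
  · linear_combination hQa + F x * ca
  · linear_combination hQb + F x * cb

/-- If the normal component `⟨n, e⟩` on a coordinate patch as in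
`normal_component_patch_equation` is nonnegative and vanishes at a point, then it vanishes near
that point. -/
theorem normal_component_eventually_eq_zero (hU : IsOpen U) (hX : ContDiffOn ℝ ∞ X U)
    (hn : ContDiffOn ℝ ∞ n U) (hψ : ContDiffOn ℝ ∞ ψ U) (hψ' : ContinuousOn ψ' U)
    (hdψ : ∀ x ∈ U, ∀ i, coordDeriv i ψ x = ψ' x * inner ℝ (coordDeriv i X x) e)
    (hunit : ∀ x ∈ U, inner ℝ (n x) (n x) = 1)
    (hnormal : ∀ x ∈ U, ∀ i, inner ℝ (coordDeriv i X x) (n x) = 0)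
    (himm : ∀ x ∈ U, inner ℝ (coordDeriv 0 X x) (coordDeriv 0 X x)
      * inner ℝ (coordDeriv 1 X x) (coordDeriv 1 X x)
      - inner ℝ (coordDeriv 0 X x) (coordDeriv 1 X x)
        * inner ℝ (coordDeriv 0 X x) (coordDeriv 1 X x) ≠ 0)
    (hmean : ∀ x ∈ U, inner ℝ (coordDeriv 1 X x) (coordDeriv 1 X x)
        * inner ℝ (coordDeriv 0 n x) (coordDeriv 0 X x)
      - 2 * inner ℝ (coordDeriv 0 X x) (coordDeriv 1 X x)
        * inner ℝ (coordDeriv 0 n x) (coordDeriv 1 X x)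
      + inner ℝ (coordDeriv 0 X x) (coordDeriv 0 X x)
        * inner ℝ (coordDeriv 1 n x) (coordDeriv 1 X x)
      = -((inner ℝ (coordDeriv 0 X x) (coordDeriv 0 X x)
          * inner ℝ (coordDeriv 1 X x) (coordDeriv 1 X x)
        - inner ℝ (coordDeriv 0 X x) (coordDeriv 1 X x)
          * inner ℝ (coordDeriv 0 X x) (coordDeriv 1 X x)) * ψ x * inner ℝ (n x) e))
    (hnn : ∀ x ∈ U, 0 ≤ inner ℝ (n x) e) {p : EuclideanSpace ℝ (Fin 2)} (hp : p ∈ U)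
    (hp0 : inner ℝ (n p) e = 0) :
    ∀ᶠ x in nhds p, inner ℝ (n x) e = 0 := by
  obtain ⟨a, ha⟩ : ∃ a, a = coordDeriv 0 X := ⟨_, rfl⟩
  obtain ⟨b, hb⟩ : ∃ b, b = coordDeriv 1 X := ⟨_, rfl⟩
  obtain ⟨aa, haa⟩ : ∃ aa, aa = coordDeriv 0 a := ⟨_, rfl⟩
  obtain ⟨ab, hab⟩ : ∃ ab, ab = coordDeriv 0 b := ⟨_, rfl⟩
  obtain ⟨bb, hbb⟩ : ∃ bb, bb = coordDeriv 1 b := ⟨_, rfl⟩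
  obtain ⟨na, hna⟩ : ∃ na, na = coordDeriv 0 n := ⟨_, rfl⟩
  obtain ⟨nb, hnb⟩ : ∃ nb, nb = coordDeriv 1 n := ⟨_, rfl⟩
  obtain ⟨naa, hnaa⟩ : ∃ naa, naa = coordDeriv 0 na := ⟨_, rfl⟩
  obtain ⟨nab, hnab⟩ : ∃ nab, nab = coordDeriv 0 nb := ⟨_, rfl⟩
  obtain ⟨nbb, hnbb⟩ : ∃ nbb, nbb = coordDeriv 1 nb := ⟨_, rfl⟩
  rw [← ha, ← hb] at himm
  simp only [← ha, ← hb, ← hna, ← hnb] at hmean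
  obtain ⟨E, hE⟩ : ∃ E : EuclideanSpace ℝ (Fin 2) → ℝ, E = fun x => inner ℝ (a x) (a x) := ⟨_, rfl⟩
  obtain ⟨F, hF⟩ : ∃ F : EuclideanSpace ℝ (Fin 2) → ℝ, F = fun x => inner ℝ (a x) (b x) := ⟨_, rfl⟩
  obtain ⟨G, hG⟩ : ∃ G : EuclideanSpace ℝ (Fin 2) → ℝ, G = fun x => inner ℝ (b x) (b x) := ⟨_, rfl⟩
  obtain ⟨W, hW⟩ : ∃ W : EuclideanSpace ℝ (Fin 2) → ℝ, W = fun x => E x * G x - F x * F x :=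
    ⟨_, rfl⟩
  have hW0 : ∀ x ∈ U, W x ≠ 0 := fun x hx => by
    rw [hW, hE, hF, hG]; exact himm x hx
  have hpde := fun x hx => normal_component_patch_equation hU hX hn hψ hdψ hunit hnormal
    ha hb haa hab hbb hna hnb hnaa hnab hnbb hE hF hG hW hW0
    (fun x hx => by rw [hW, hE, hF, hG]; exact hmean x hx) (x := x) hx
  have sa : ContDiffOn ℝ ∞ a U := ha ▸ hX.coordDeriv hU 0
  have sb : ContDiffOn ℝ ∞ b U := hb ▸ hX.coordDeriv hU 1
  have sna : ContDiffOn ℝ ∞ na U := hna ▸ hn.coordDeriv hU 0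
  have snb : ContDiffOn ℝ ∞ nb U := hnb ▸ hn.coordDeriv hU 1
  have caa : ContinuousOn aa U := haa ▸ (sa.coordDeriv hU 0).continuousOn
  have cab : ContinuousOn ab U := hab ▸ (sb.coordDeriv hU 0).continuousOn
  have cbb : ContinuousOn bb U := hbb ▸ (sb.coordDeriv hU 1).continuousOn
  have ca := sa.continuousOn
  have cb := sb.continuousOn
  have cna := sna.continuousOn
  have cnb := snb.continuousOn
  have cψ := hψ.continuousOn
  have cE : ContinuousOn E U := by rw [hE]; fun_prop
  have cF : ContinuousOn F U := by rw [hF]; fun_prop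
  have cG : ContinuousOn G U := by rw [hG]; fun_prop
  have cW : ContinuousOn W U := by rw [hW]; fun_prop
  have cWi : ContinuousOn (fun x => (W x)⁻¹) U := cW.inv₀ hW0
  have se : ContDiffOn ℝ ∞ (fun _ => e) U := contDiffOn_const
  have su : ContDiffOn ℝ ∞ (fun x => inner ℝ (n x) e) U := hn.inner ℝ se
  have hdu : ∀ i, ∀ k : EuclideanSpace ℝ (Fin 2) → E3, ContDiffOn ℝ ∞ k U → ∀ x ∈ U,
      coordDeriv i (fun x => inner ℝ (k x) e) x = inner ℝ (coordDeriv i k x) e := by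
    intro i k hk x hx
    have : coordDeriv i (fun _ => e) x = 0 := by simp [coordDeriv]
    rw [coordDeriv_inner hU hk se hx, this, inner_zero_right, add_zero]
  have hddu : ∀ x ∈ U, ∀ i j, fderiv ℝ (fderiv ℝ fun x => inner ℝ (n x) e) x (coordVec i)
      (coordVec j) = inner ℝ (coordDeriv i (coordDeriv j n) x) e := by
    intro x hx i j
    rw [← coordDeriv_coordDeriv hU su hx, coordDeriv_congr hU hx (hdu j n hn),
      hdu i _ (hn.coordDeriv hU j) x hx]
  -- The principal symbol `G ξ₀² - 2 F ξ₀ ξ₁ + E ξ₁²` equals `|ξ₀ b - ξ₁ a|²`, so the three ambient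
  -- components of `ξ₀ b - ξ₁ a` supply the squares without any diagonalisation.
  refine eventually_eq_zero_of_nonneg_supersolution (ι := Fin 3) hU
    (u := fun x => inner ℝ (n x) e) (su.of_le two_le_smooth)
    (V := fun k x => (b x k) • coordVec 0 - (a x k) • coordVec 1)
    (b := fun x =>
      ((W x)⁻¹ * (W x * ψ x * (G x * inner ℝ (a x) e - F x * inner ℝ (b x) e)
          - (G x * inner ℝ (G x • aa x - (2 * F x) • ab x + E x • bb x) (a x)
            - F x * inner ℝ (G x • aa x - (2 * F x) • ab x + E x • bb x) (b x)))) • coordVec 0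
      + ((W x)⁻¹ * (W x * ψ x * (E x * inner ℝ (b x) e - F x * inner ℝ (a x) e)
          - (E x * inner ℝ (G x • aa x - (2 * F x) • ab x + E x • bb x) (b x)
            - F x * inner ℝ (G x • aa x - (2 * F x) • ab x + E x • bb x) (a x)))) • coordVec 1)
    (c := fun x => ψ' x * (G x * inner ℝ (a x) e ^ 2
        - 2 * F x * inner ℝ (a x) e * inner ℝ (b x) e + E x * inner ℝ (b x) e ^ 2)
      + (G x * inner ℝ (na x) (na x) - 2 * F x * inner ℝ (na x) (nb x)
        + E x * inner ℝ (nb x) (nb x)))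
    ?_ ?_ ?_ ?_ ?_ hnn hp hp0
  · intro k
    fun_prop
  · intro x hx d hd
    by_contra! h
    have hk : ∀ k, d 0 * b x k = d 1 * a x k := fun k => by
      have := h k
      simp only [coordVec, inner_sub_right, real_inner_smul_right,
        EuclideanSpace.inner_single_right, conj_trivial, one_mul] at this
      linarith
    -- A direction orthogonal to all three fields would be a linear relation between the independent
    -- vectors `a x` and `b x`.
    have hvec : d 0 • b x = d 1 • a x := by
      ext k; simpa using hk k
    have h1 := congrArg (fun z => inner ℝ z (a x)) hvec
    have h2 := congrArg (fun z => inner ℝ z (b x)) hvec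
    simp only [real_inner_smul_left] at h1 h2
    rw [real_inner_comm (a x) (b x)] at h1
    have hWx := himm x hx
    have d0 : d 0 = 0 := (mul_eq_zero.1 (show _ * d 0 = 0 by
      linear_combination inner ℝ (a x) (a x) * h2 - inner ℝ (a x) (b x) * h1)).resolve_left hWx
    have d1 : d 1 = 0 := (mul_eq_zero.1 (show _ * d 1 = 0 by
      linear_combination inner ℝ (a x) (b x) * h2 - inner ℝ (b x) (b x) * h1)).resolve_left hWx
    exact hd (by ext i; fin_cases i <;> simp [d0, d1])
  · fun_prop
  · fun_prop
  · intro x hx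
    refine le_of_eq ((?_ : _ = _).trans (hpde x hx))
    congr 1
    congr 1
    · simp only [map_sub, map_smul, sub_apply, smul_apply,
        hddu x hx, smul_eq_mul]
      rw [coordDeriv_comm hU hn hx 1 0, ← hna, ← hnb, ← hnaa, ← hnab, ← hnbb, hE, hF, hG]
      simp only [Fin.sum_univ_three, PiLp.inner_apply, RCLike.inner_apply, conj_trivial]
      ring
    · have h0 := hdu 0 n hn x hx
      have h1 := hdu 1 n hn x hx
      simp only [coordDeriv] at h0 h1
      rw [map_add, map_smul, map_smul, h0, h1, hna, hnb]
      rfl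

end Patch

/-! ### Positivity of the slope of `φ`. -/

section Slope

/-- A strictly increasing function `φ` with `φ'' + λ φ'² ≥ 0` has no critical point,
because `exp (λ φ) φ'` is monotone. -/
theorem deriv_pos_of_strictMonoOn_of_nonneg {I : Set ℝ} (hI_open : IsOpen I)
    (hI_conn : I.OrdConnected) {φ : ℝ → ℝ} (hφ_smooth : ContDiffOn ℝ ∞ φ I)
    (hφ_mono : StrictMonoOn φ I) {lam : ℝ}
    (hφ : ∀ t ∈ I, 0 ≤ deriv (deriv φ) t + lam * (deriv φ t) ^ 2) {t : ℝ} (ht : t ∈ I) :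
    0 < deriv φ t := by
  have hd : ∀ s ∈ I, HasDerivAt φ (deriv φ s) s := fun s hs =>
    ((hφ_smooth.contDiffAt (hI_open.mem_nhds hs)).differentiableAt (by simp)).hasDerivAt
  have hdd : ∀ s ∈ I, HasDerivAt (deriv φ) (deriv (deriv φ) s) s := fun s hs =>
    (((hφ_smooth.deriv_of_isOpen hI_open (m := ∞) (by simp)).contDiffAt
      (hI_open.mem_nhds hs)).differentiableAt (by simp)).hasDerivAt
  obtain ⟨δ, hδ, hball⟩ := Metric.isOpen_iff.1 hI_open t ht
  set s := t - δ / 2 with hs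
  have hst : s < t := by linarith
  have hsI : s ∈ I := hball (by 
    rw [Metric.mem_ball, Real.dist_eq, hs, show t - δ / 2 - t = -(δ / 2) by ring, abs_neg,
      abs_of_pos (by linarith)]
    linarith)
  have hsub : Set.Icc s t ⊆ I := hI_conn.out hsI ht
  have hw : ∀ r ∈ I, HasDerivAt (fun r => Real.exp (lam * φ r) * deriv φ r)
      (Real.exp (lam * φ r) * (deriv (deriv φ) r + lam * deriv φ r ^ 2)) r := fun r hr => by
    refine ((((hd r hr).const_mul lam).exp).mul (hdd r hr)).congr_deriv ?_
    ring
  have hmono : MonotoneOn (fun r => Real.exp (lam * φ r) * deriv φ r) (Set.Icc s t) := by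
    refine monotoneOn_of_deriv_nonneg (convex_Icc s t)
      (fun r hr => (hw r (hsub hr)).continuousAt.continuousWithinAt)
      (fun r hr => (hw r (hsub (interior_subset hr))).differentiableAt.differentiableWithinAt) ?_
    intro r hr
    have hrI := hsub (interior_subset hr)
    rw [(hw r hrI).deriv]
    exact mul_nonneg (Real.exp_pos _).le (hφ r hrI)
  by_contra! hle
  -- A nonpositive value of the monotone function `exp (λ φ) φ'` at `t` propagates to the left,
  -- which is why `s` was taken below `t`.
  have hle' : ∀ r ∈ Set.Icc s t, deriv φ r ≤ 0 := by
    intro r hr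
    have h1 := hmono hr (Set.right_mem_Icc.2 hst.le) hr.2
    have h2 : Real.exp (lam * φ t) * deriv φ t ≤ 0 :=
      mul_nonpos_of_nonneg_of_nonpos (Real.exp_pos _).le hle
    have h3 : Real.exp (lam * φ r) * deriv φ r ≤ 0 := le_trans h1 h2
    by_contra! h4
    exact absurd (mul_pos (Real.exp_pos (lam * φ r)) h4) (not_lt.2 h3)
  have hanti : AntitoneOn φ (Set.Icc s t) :=
    antitoneOn_of_deriv_nonpos (convex_Icc s t)
      (fun r hr => (hd r (hsub hr)).continuousAt.continuousWithinAt)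
      (fun r hr => (hd r (hsub (interior_subset hr))).differentiableAt.differentiableWithinAt)
      fun r hr => hle' r (interior_subset hr)
  exact absurd (hφ_mono hsI ht hst)
    (not_lt.2 (hanti (Set.left_mem_Icc.2 hst.le) (Set.right_mem_Icc.2 hst.le) hst.le))

end Slope

/-! ### The mean curvature as a basis-independent trace. -/

section MeanTrace

local notation "E2" => EuclideanSpace ℝ (Fin 2)

/-- The trace of `⟨B u, A v⟩` with respect to `⟨A u, A v⟩`. -/
noncomputable def relTrace (A B : E2 →L[ℝ] E3) : ℝ :=
  ((Matrix.of fun i j => inner ℝ (A (coordVec i)) (A (coordVec j)))⁻¹ *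
    Matrix.of fun i j => inner ℝ (B (coordVec i)) (A (coordVec j))).trace

theorem eq_sum_coordVec (v : E2) : v = v 0 • coordVec 0 + v 1 • coordVec 1 := by
  ext i; fin_cases i <;> simp [coordVec]

/-- With `a`, `b` the images of the coordinate vectors, `|b|² a - ⟨a, b⟩ b` has squared norm `|b|²`
times the determinant. If that is zero, injectivity forces `|b|² = 0`, which contradicts injectivity
again. -/
theorem gram_det_ne_zero {A : E2 →L[ℝ] E3} (hA : Function.Injective A) :
    inner ℝ (A (coordVec 0)) (A (coordVec 0)) * inner ℝ (A (coordVec 1)) (A (coordVec 1))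
      - inner ℝ (A (coordVec 0)) (A (coordVec 1)) * inner ℝ (A (coordVec 0)) (A (coordVec 1))
      ≠ 0 := by
  intro h
  set a := A (coordVec 0)
  set b := A (coordVec 1)
  have hz : A (inner ℝ b b • coordVec 0 - inner ℝ a b • coordVec 1) = 0 := by
    rw [map_sub, map_smul, map_smul]
    change inner ℝ b b • a - inner ℝ a b • b = 0
    rw [← inner_self_eq_zero (𝕜 := ℝ)]
    simp only [inner_sub_left, inner_sub_right, real_inner_smul_left, real_inner_smul_right,
      real_inner_comm a b]
    linear_combination inner ℝ b b * h
  have hv := hA (hz.trans (map_zero A).symm)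
  have hb : inner ℝ b b = 0 := by
    have := congrArg (fun v : E2 => v 0) hv
    simpa [coordVec] using this
  have hb' : A (coordVec 1) = 0 := inner_self_eq_zero.1 hb
  have := congrArg (fun v : E2 => v 1) (hA (hb'.trans (map_zero A).symm))
  simp [coordVec] at this

/-- The relative trace by Cramer's rule. -/
theorem relTrace_mul_gram_det {A B : E2 →L[ℝ] E3} (hA : Function.Injective A) :
    relTrace A B * (inner ℝ (A (coordVec 0)) (A (coordVec 0))
        * inner ℝ (A (coordVec 1)) (A (coordVec 1))
      - inner ℝ (A (coordVec 0)) (A (coordVec 1)) * inner ℝ (A (coordVec 0)) (A (coordVec 1)))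
    = inner ℝ (A (coordVec 1)) (A (coordVec 1)) * inner ℝ (B (coordVec 0)) (A (coordVec 0))
      - inner ℝ (A (coordVec 0)) (A (coordVec 1))
        * (inner ℝ (B (coordVec 0)) (A (coordVec 1)) + inner ℝ (B (coordVec 1)) (A (coordVec 0)))
      + inner ℝ (A (coordVec 0)) (A (coordVec 0)) * inner ℝ (B (coordVec 1)) (A (coordVec 1)) := by
  have hW := gram_det_ne_zero hA
  rw [relTrace, Matrix.inv_def, Matrix.det_fin_two, Matrix.adjugate_fin_two,
    Ring.inverse_eq_inv', Matrix.smul_mul, Matrix.trace_smul, Matrix.trace_fin_two,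
    Matrix.mul_apply, Matrix.mul_apply, Fin.sum_univ_two, Fin.sum_univ_two]
  simp only [Matrix.of_apply, Matrix.cons_val', Matrix.cons_val_zero, Matrix.cons_val_one,
    Matrix.cons_val_fin_one, smul_eq_mul]
  rw [real_inner_comm (A (coordVec 0)) (A (coordVec 1))]
  have hWW := mul_inv_cancel₀ hW
  set a := A (coordVec 0)
  set b := A (coordVec 1)
  linear_combination (inner ℝ b b * inner ℝ (B (coordVec 0)) a
    - inner ℝ a b * (inner ℝ (B (coordVec 0)) b + inner ℝ (B (coordVec 1)) a)
    + inner ℝ a a * inner ℝ (B (coordVec 1)) b) * hWW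

/-- The relative trace does not depend on the basis. -/
theorem relTrace_comp {A B : E2 →L[ℝ] E3} {J : E2 →L[ℝ] E2} (hA : Function.Injective A)
    (hJ : Function.Injective J) : relTrace (A.comp J) (B.comp J) = relTrace A B := by
  have hAJ : Function.Injective (A.comp J) := hA.comp hJ
  have h := relTrace_mul_gram_det (B := B) hA
  have h' := relTrace_mul_gram_det (B := B.comp J) hAJ
  have hW' := gram_det_ne_zero hAJ
  simp only [ContinuousLinearMap.comp_apply] at h' hW'
  rw [eq_sum_coordVec (J (coordVec 0)), eq_sum_coordVec (J (coordVec 1))] at h' hW'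
  set p := J (coordVec 0) 0
  set q := J (coordVec 0) 1
  set r := J (coordVec 1) 0
  set s := J (coordVec 1) 1
  set a := A (coordVec 0)
  set b := A (coordVec 1)
  simp only [map_add, map_smul, inner_add_left, inner_add_right, real_inner_smul_left,
    real_inner_smul_right] at h' hW'
  rw [real_inner_comm (A (coordVec 0)) (A (coordVec 1))] at h' hW'
  refine mul_right_cancel₀ hW' (h'.trans ?_)
  -- The Gram determinant and the Cramer numerator both scale by `(det J)²`.
  linear_combination -(p * s - q * r) ^ 2 * h

end MeanTrace

/-! ### Vanishing of a trace-free second fundamental form with a kernel. -/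

section Umbilic

/-- The derivatives of a unit normal vanish at a point where the mean curvature is zero and a
fixed nonzero tangent direction is orthogonal to them. -/
theorem normal_jet_eq_zero {a b n na nb e : E3} (hn : inner ℝ n n = 1)
    (han : inner ℝ a n = 0) (hbn : inner ℝ b n = 0)
    (hW0 : inner ℝ a a * inner ℝ b b - inner ℝ a b ^ 2 ≠ 0)
    (hna : inner ℝ na n = 0) (hnb : inner ℝ nb n = 0) (hsym : inner ℝ na b = inner ℝ nb a)
    (hQ : inner ℝ b b * inner ℝ na a - 2 * inner ℝ a b * inner ℝ na b
      + inner ℝ a a * inner ℝ nb b = 0)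
    (he : e ≠ 0) (hen : inner ℝ e n = 0) (hnae : inner ℝ na e = 0) (hnbe : inner ℝ nb e = 0) :
    na = 0 ∧ nb = 0 := by
  have hfr := inner_eq_of_frame hn han hbn hW0
  have hA := hfr na e
  have hB := hfr nb e
  have hE := hfr e e
  rw [hnae, hna] at hA
  rw [hnbe, hnb] at hB
  rw [hen] at hE
  rw [← hsym] at hB
  set E := inner ℝ a a
  set F := inner ℝ a b
  set G := inner ℝ b b
  set μ := inner ℝ e a
  set ν := inner ℝ e b
  have hee : inner ℝ e e ≠ 0 := fun h => he (inner_self_eq_zero.1 h)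
  have hpos : (E * G - F ^ 2) ^ 2 * inner ℝ e e ≠ 0 := mul_ne_zero (pow_ne_zero 2 hW0) hee
  -- `(G μ - F ν, E ν - F μ)` are the coordinates of `(E G - F²) e` in the basis `a`, `b`. Thus
  -- `hA`, `hB` say that `e` lies in the kernel of the second form and `hQ` that its trace is zero:
  -- a linear system for the three entries.
  have k1 : inner ℝ na a = 0 := by
    refine (mul_eq_zero.1 (?_ : (E * G - F ^ 2) ^ 2 * inner ℝ e e * _ = 0)).resolve_left hpos
    linear_combination (E * G - F ^ 2) * inner ℝ na a * hE + (E * ν - F * μ) ^ 2 * hQ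
      - (E * (G * μ - F * ν) + 2 * F * (E * ν - F * μ)) * hA + E * (E * ν - F * μ) * hB
  have k2 : inner ℝ na b = 0 := by
    refine (mul_eq_zero.1 (?_ : (E * G - F ^ 2) ^ 2 * inner ℝ e e * _ = 0)).resolve_left hpos
    linear_combination (E * G - F ^ 2) * inner ℝ na b * hE
      - (G * μ - F * ν) * (E * ν - F * μ) * hQ
      - G * (E * ν - F * μ) * hA - E * (G * μ - F * ν) * hB
  have k3 : inner ℝ nb b = 0 := by
    refine (mul_eq_zero.1 (?_ : (E * G - F ^ 2) ^ 2 * inner ℝ e e * _ = 0)).resolve_left hpos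
    linear_combination (E * G - F ^ 2) * inner ℝ nb b * hE + (G * μ - F * ν) ^ 2 * hQ
      - (G * (E * ν - F * μ) + 2 * F * (G * μ - F * ν)) * hB + G * (G * μ - F * ν) * hA
  constructor
  · have h := hfr na na
    rw [k1, k2, hna] at h
    exact inner_self_eq_zero.1 ((mul_eq_zero.1 (h.trans (by ring))).resolve_left hW0)
  · have h := hfr nb nb
    rw [← hsym, k2, k3, hnb] at h
    exact inner_self_eq_zero.1 ((mul_eq_zero.1 (h.trans (by ring))).resolve_left hW0)

end Umbilic

/-! ### Passage between the intrinsic differential and a fixed chart. -/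

section Chart

local notation "E2" => EuclideanSpace ℝ (Fin 2)

variable {M : Type*} [TopologicalSpace M] [ChartedSpace E2 M]

/-- The coordinates implicit in `meanCurvature` change with the point, as does its preferred chart.
In the form `relTrace` it can be computed in one fixed chart by `relTrace_comp`. -/
theorem meanCurvature_eq_relTrace (f N : M → E3) (p : M) :
    meanCurvature f N p = relTrace (surfDiff f p) (surfDiff N p) := rfl

variable [IsManifold (𝓡 2) ∞ M]

theorem contDiffOn_comp_chart_symm {V : Type*} [NormedAddCommGroup V] [NormedSpace ℝ V]
    {k : M → V} (hk : ContMDiff (𝓡 2) 𝓘(ℝ, V) ∞ k) (p : M) :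
    ContDiffOn ℝ ∞ (fun x => k ((chartAt E2 p).symm x)) (chartAt E2 p).target :=
  contMDiffOn_iff_contDiffOn.1 (hk.comp_contMDiffOn (contMDiffOn_chart_symm (I := 𝓡 2)))

/-- The differential of a map read in an arbitrary chart is the intrinsic differential composed
with a linear automorphism that does not depend on the map. -/
theorem exists_fderiv_comp_chart_symm (p : M) {x : E2} (hx : x ∈ (chartAt E2 p).target) :
    ∃ J : E2 →L[ℝ] E2, Function.Injective J ∧
      ∀ k : M → E3, ContMDiff (𝓡 2) 𝓘(ℝ, E3) ∞ k →
        fderiv ℝ (fun x => k ((chartAt E2 p).symm x)) x =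
          (surfDiff k ((chartAt E2 p).symm x)).comp J := by
  have hmd : (chartAt E2 p).MDifferentiable (𝓡 2) (𝓡 2) :=
    mdifferentiable_of_mem_atlas (chart_mem_atlas E2 p)
  refine ⟨mfderiv (𝓡 2) (𝓡 2) (chartAt E2 p).symm x, ?_, fun k hk => ?_⟩
  -- The derivative of the chart is a left inverse of `J`.
  · have h := hmd.comp_symm_deriv hx
    intro u v huv
    have hu := DFunLike.congr_fun h u
    have hv := DFunLike.congr_fun h v
    exact hu.symm.trans ((congrArg _ huv).trans hv)
  · rw [← mfderiv_eq_fderiv]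
    exact mfderiv_comp x (hk.mdifferentiableAt (by simp)) (hmd.mdifferentiableAt_symm hx)

/-- A map whose differential vanishes in all charts is constant on a connected surface. -/
theorem eq_of_fderiv_chart_eq_zero [ConnectedSpace M] {V : Type*} [NormedAddCommGroup V]
    [NormedSpace ℝ V] {k : M → V} (hk : ContMDiff (𝓡 2) 𝓘(ℝ, V) ∞ k)
    (h0 : ∀ p, ∀ x ∈ (chartAt E2 p).target,
      fderiv ℝ (fun x => k ((chartAt E2 p).symm x)) x = 0) (p q : M) : k p = k q := by
  have hloc : IsLocallyConstant k := by
    rw [IsLocallyConstant.iff_eventually_eq]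
    intro p
    have hpt := mem_chart_target E2 p
    obtain ⟨r, hr, hball⟩ := Metric.isOpen_iff.1 (chartAt E2 p).open_target _ hpt
    have hsrc : ∀ᶠ y in nhds p, y ∈ (chartAt E2 p).source :=
      (chartAt E2 p).open_source.mem_nhds (mem_chart_source E2 p)
    have hnear : ∀ᶠ y in nhds p, chartAt E2 p y ∈ Metric.ball (chartAt E2 p p) r :=
      ((chartAt E2 p).continuousAt (mem_chart_source E2 p)).eventually
        (Metric.ball_mem_nhds _ hr)
    filter_upwards [hsrc, hnear] with y hy hyr
    have := Metric.isOpen_ball.is_const_of_fderiv_eq_zero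
      (convex_ball (chartAt E2 p p) r).isPreconnected
      (((contDiffOn_comp_chart_symm hk p).differentiableOn (by simp)).mono hball)
      (fun x hx => h0 p x (hball hx)) hyr (Metric.mem_ball_self hr)
    rwa [(chartAt E2 p).left_inv hy, (chartAt E2 p).left_inv (mem_chart_source E2 p)] at this
  exact hloc.apply_eq_of_preconnectedSpace p q

end Chart

/-! ### Functions of the height coordinate. -/

section Slab

theorem inner_e3 (v : E3) : inner ℝ v e3 = v 2 := by
  simp [e3, EuclideanSpace.inner_single_right]

theorem e3_ne_zero : e3 ≠ 0 := by
  intro h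
  have := congrArg (fun v : E3 => v 2) h
  simp [e3] at this

/-- Serves twice: with `X` the identity it evaluates the gradient of `φ(x₃)`, and with `g = φ'` on a
patch it gives the differential of `ψ` in terms of `φ''`. -/
theorem fderiv_comp_height {E : Type*} [NormedAddCommGroup E] [NormedSpace ℝ E] {g : ℝ → ℝ}
    {X : E → E3} {X' : E →L[ℝ] E3} {x : E} (hg : DifferentiableAt ℝ g (X x 2))
    (hX : HasFDerivAt X X' x) (v : E) :
    fderiv ℝ (fun y => g (X y 2)) x v = deriv g (X x 2) * inner ℝ (X' v) e3 := by
  have h2 : HasFDerivAt (fun y => X y 2) ((EuclideanSpace.proj 2).comp X') x :=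
    (EuclideanSpace.proj (𝕜 := ℝ) (2 : Fin 3)).hasFDerivAt.comp x hX
  have h := hg.hasDerivAt.comp_hasFDerivAt x h2
  change fderiv ℝ (g ∘ fun y => X y 2) x v = _
  rw [h.fderiv, inner_e3]
  simp

end Slab

/-! ### Global consequences on a connected surface. -/

section Surface

local notation "E2" => EuclideanSpace ℝ (Fin 2)

variable {M : Type*} [TopologicalSpace M] [ChartedSpace E2 M] {φ : ℝ → ℝ} {I : Set ℝ}
  {f N : M → E3}

theorem IsPhiMinimal.meanCurvature_eq_deriv (hf : IsPhiMinimal φ I f N) (hI : IsOpen I)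
    (hφ : ContDiffOn ℝ ∞ φ I) (p : M) :
    meanCurvature f N p = -(deriv φ (f p 2) * inner ℝ (N p) e3) := by
  have hd : DifferentiableAt ℝ φ (f p 2) :=
    (hφ.contDiffAt (hI.mem_nhds (hf.mem_slab p))).differentiableAt (by simp)
  rw [hf.meanCurvature_eq, inner_gradient_left]
  congr 1
  exact fderiv_comp_height (X := fun x : E3 => x) hd (hasFDerivAt_id (f p)) (N p)

theorem IsGaussMap.inner_self (hN : IsGaussMap f N) (q : M) :
    inner ℝ (N q) (N q) = 1 := by
  rw [real_inner_self_eq_norm_sq, hN.norm_eq_one]; norm_num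

variable [IsManifold (𝓡 2) ∞ M]

theorem IsGaussMap.patch_normal (hf : IsSmoothImmersion f) (hN : IsGaussMap f N) (p : M) {x : E2}
    (hx : x ∈ (chartAt E2 p).target) (i : Fin 2) :
    inner ℝ (coordDeriv i (fun x => f ((chartAt E2 p).symm x)) x) (N ((chartAt E2 p).symm x))
      = 0 := by
  obtain ⟨J, -, hJ⟩ := exists_fderiv_comp_chart_symm p hx
  rw [coordDeriv, hJ f hf.smooth]
  exact hN.normal _ _

theorem IsSmoothImmersion.patch_gram_det_ne_zero (hf : IsSmoothImmersion f) (p : M) {x : E2}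
    (hx : x ∈ (chartAt E2 p).target) {X : E2 → E3}
    (hX : X = fun x => f ((chartAt E2 p).symm x)) :
    inner ℝ (coordDeriv 0 X x) (coordDeriv 0 X x) * inner ℝ (coordDeriv 1 X x) (coordDeriv 1 X x)
      - inner ℝ (coordDeriv 0 X x) (coordDeriv 1 X x)
        * inner ℝ (coordDeriv 0 X x) (coordDeriv 1 X x) ≠ 0 := by
  obtain ⟨J, hJi, hJ⟩ := exists_fderiv_comp_chart_symm p hx
  subst hX
  refine gram_det_ne_zero (A := fderiv ℝ (fun x => f ((chartAt E2 p).symm x)) x) ?_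
  rw [hJ f hf.smooth]
  exact (hf.injective_diff _).comp hJi

/-- The mean curvature in an arbitrary chart, by Cramer's rule. -/
theorem IsGaussMap.patch_meanCurvature (hf : IsSmoothImmersion f) (hN : IsGaussMap f N) (p : M)
    {x : E2} (hx : x ∈ (chartAt E2 p).target) {X n : E2 → E3}
    (hX : X = fun x => f ((chartAt E2 p).symm x)) (hn : n = fun x => N ((chartAt E2 p).symm x)) :
    inner ℝ (coordDeriv 1 X x) (coordDeriv 1 X x) * inner ℝ (coordDeriv 0 n x) (coordDeriv 0 X x)
      - 2 * inner ℝ (coordDeriv 0 X x) (coordDeriv 1 X x)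
        * inner ℝ (coordDeriv 0 n x) (coordDeriv 1 X x)
      + inner ℝ (coordDeriv 0 X x) (coordDeriv 0 X x)
        * inner ℝ (coordDeriv 1 n x) (coordDeriv 1 X x)
      = meanCurvature f N ((chartAt E2 p).symm x)
        * (inner ℝ (coordDeriv 0 X x) (coordDeriv 0 X x)
          * inner ℝ (coordDeriv 1 X x) (coordDeriv 1 X x)
        - inner ℝ (coordDeriv 0 X x) (coordDeriv 1 X x)
          * inner ℝ (coordDeriv 0 X x) (coordDeriv 1 X x)) := by
  have hsym : inner ℝ (coordDeriv 1 n x) (coordDeriv 0 X x)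
      = inner ℝ (coordDeriv 0 n x) (coordDeriv 1 X x) := by
    subst hX hn
    exact inner_coordDeriv_normal_symm (chartAt E2 p).open_target
      (contDiffOn_comp_chart_symm hf.smooth p) (contDiffOn_comp_chart_symm hN.smooth p)
      (fun y hy i => hN.patch_normal hf p hy i) hx 1 0
  obtain ⟨J, hJi, hJ⟩ := exists_fderiv_comp_chart_symm p hx
  have hXJ := hJ f hf.smooth
  have hnJ := hJ N hN.smooth
  rw [← hX] at hXJ
  rw [← hn] at hnJ
  have hinj := hf.injective_diff ((chartAt E2 p).symm x)
  have h := relTrace_mul_gram_det (A := fderiv ℝ X x) (B := fderiv ℝ n x)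
    (by rw [hXJ]; exact hinj.comp hJi)
  have htr : relTrace (fderiv ℝ X x) (fderiv ℝ n x)
      = meanCurvature f N ((chartAt E2 p).symm x) := by
    rw [hXJ, hnJ, relTrace_comp hinj hJi, meanCurvature_eq_relTrace]
  rw [htr] at h
  refine Eq.trans ?_ h.symm
  change _ = inner ℝ (coordDeriv 1 X x) (coordDeriv 1 X x)
      * inner ℝ (coordDeriv 0 n x) (coordDeriv 0 X x)
    - inner ℝ (coordDeriv 0 X x) (coordDeriv 1 X x)
      * (inner ℝ (coordDeriv 0 n x) (coordDeriv 1 X x)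
        + inner ℝ (coordDeriv 1 n x) (coordDeriv 0 X x))
    + inner ℝ (coordDeriv 0 X x) (coordDeriv 0 X x)
      * inner ℝ (coordDeriv 1 n x) (coordDeriv 1 X x)
  rw [hsym]
  ring

/-- If the angle function `⟨N, e₃⟩` of a `[φ, e₃]`-minimal immersion of a connected surface is
nonnegative and vanishes at a point, then it vanishes identically. -/
theorem IsPhiMinimal.inner_e3_eq_zero [ConnectedSpace M] (hf : IsPhiMinimal φ I f N)
    (hI : IsOpen I) (hφ : ContDiffOn ℝ ∞ φ I) (hnn : ∀ p, 0 ≤ inner ℝ (N p) e3)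
    (hzero : ∃ p, inner ℝ (N p) e3 = 0) (p : M) : inner ℝ (N p) e3 = 0 := by
  have hNc : Continuous N := hf.gaussMap.smooth.continuous
  have hclosed : IsClosed {p | inner ℝ (N p) e3 = 0} :=
    isClosed_eq (by fun_prop) continuous_const
  -- Openness is the strong minimum principle in the chart at `p`, with `ψ = φ'` and `ψ' = φ''`
  -- evaluated at the height.
  have hopen : IsOpen {p | inner ℝ (N p) e3 = 0} := by
    rw [isOpen_iff_mem_nhds]
    intro p hp
    have hpt := mem_chart_target E2 p
    have hU := (chartAt E2 p).open_target
    have sX := contDiffOn_comp_chart_symm hf.immersion.smooth p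
    have sφ' : ContDiffOn ℝ ∞ (deriv φ) I := hφ.deriv_of_isOpen hI (by simp)
    have sφ'' : ContDiffOn ℝ ∞ (deriv (deriv φ)) I := sφ'.deriv_of_isOpen hI (by simp)
    have sh : ContDiffOn ℝ ∞ (fun x => f ((chartAt E2 p).symm x) 2) (chartAt E2 p).target :=
      (EuclideanSpace.proj (𝕜 := ℝ) (2 : Fin 3)).contDiff.comp_contDiffOn sX
    have hmaps : Set.MapsTo (fun x => f ((chartAt E2 p).symm x) 2) (chartAt E2 p).target I :=
      fun x _ => hf.mem_slab _
    have hev := normal_component_eventually_eq_zero hU sX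
      (contDiffOn_comp_chart_symm hf.gaussMap.smooth p)
      (ψ := fun x => deriv φ (f ((chartAt E2 p).symm x) 2))
      (ψ' := fun x => deriv (deriv φ) (f ((chartAt E2 p).symm x) 2)) (e := e3)
      (sφ'.comp sh hmaps) (sφ''.continuousOn.comp sh.continuousOn hmaps)
      (fun x hx i => fderiv_comp_height (X := fun x => f ((chartAt E2 p).symm x))
        ((sφ'.contDiffAt (hI.mem_nhds (hmaps hx))).differentiableAt (by simp))
        ((sX.contDiffAt (hU.mem_nhds hx)).differentiableAt (by simp)).hasFDerivAt _)
      (fun x _ => hf.gaussMap.inner_self _)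
      (fun x hx i => hf.gaussMap.patch_normal hf.immersion p hx i)
      (fun x hx => hf.immersion.patch_gram_det_ne_zero p hx rfl)
      (fun x hx => by
        rw [hf.gaussMap.patch_meanCurvature hf.immersion p hx rfl rfl,
          hf.meanCurvature_eq_deriv hI hφ]
        ring)
      (fun x _ => hnn _) hpt
      (by rw [(chartAt E2 p).left_inv (mem_chart_source E2 p)]; exact hp)
    have hsrc : ∀ᶠ y in nhds p, y ∈ (chartAt E2 p).source :=
      (chartAt E2 p).open_source.mem_nhds (mem_chart_source E2 p)
    filter_upwards [hsrc,
      ((chartAt E2 p).continuousAt (mem_chart_source E2 p)).eventually hev] with y hy hy0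
    rwa [(chartAt E2 p).left_inv hy] at hy0
  have huniv := IsClopen.eq_univ ⟨hclosed, hopen⟩ hzero
  exact Set.eq_univ_iff_forall.1 huniv p

/-- The Gauss map is constant if the mean curvature and the angle function `⟨N, e₃⟩` vanish. -/
theorem IsGaussMap.eq_of_minimal_of_vertical [ConnectedSpace M] (hf : IsSmoothImmersion f)
    (hN : IsGaussMap f N) (hH : ∀ p, meanCurvature f N p = 0)
    (hv : ∀ p, inner ℝ (N p) e3 = 0) (p q : M) : N p = N q := by
  refine eq_of_fderiv_chart_eq_zero hN.smooth (fun p x hx => ?_) p q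
  have hU := (chartAt E2 p).open_target
  have sX := contDiffOn_comp_chart_symm hf.smooth p
  have sn := contDiffOn_comp_chart_symm hN.smooth p
  have hnorm := fun y hy i => hN.patch_normal hf p (x := y) hy i
  have hunit : ∀ y ∈ (chartAt E2 p).target,
      inner ℝ (N ((chartAt E2 p).symm y)) (N ((chartAt E2 p).symm y)) = 1 :=
    fun y _ => hN.inner_self _
  have hmean := hN.patch_meanCurvature hf p hx rfl rfl
  rw [hH, zero_mul] at hmean
  have hW := hf.patch_gram_det_ne_zero p hx rfl
  rw [← pow_two (inner ℝ (coordDeriv 0 _ x) (coordDeriv 1 _ x))] at hW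
  -- Differentiating `⟨N, e₃⟩ = 0` shows that the tangent vector `e₃` is in the kernel of the second
  -- form.
  have hve : ∀ i, inner ℝ (coordDeriv i (fun x => N ((chartAt E2 p).symm x)) x) e3 = 0 := by
    intro i
    have h := coordDeriv_congr hU hx (fun y _ => hv ((chartAt E2 p).symm y)) i
    rw [coordDeriv_inner hU sn contDiffOn_const hx, coordDeriv_const] at h
    have h0 : coordDeriv i (fun _ => e3) x = 0 := by simp [coordDeriv]
    rwa [h0, inner_zero_right, add_zero] at h
  obtain ⟨h0, h1⟩ := normal_jet_eq_zero (hunit x hx) (hnorm x hx 0) (hnorm x hx 1) hW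
    (inner_coordDeriv_normal_self hU sn hunit hx 0) (inner_coordDeriv_normal_self hU sn hunit hx 1)
    (inner_coordDeriv_normal_symm hU sX sn hnorm hx 0 1) hmean e3_ne_zero
    (by rw [real_inner_comm]; exact hv _) (hve 0) (hve 1)
  ext1 v
  rw [eq_sum_coordVec v, map_add, map_smul, map_smul]
  change v 0 • coordDeriv 0 _ x + v 1 • coordDeriv 1 _ x = _
  rw [h0, h1]
  simp

/-- An immersion with constant Gauss map lies in an affine plane. -/
theorem IsGaussMap.inner_eq_of_const [ConnectedSpace M] (hf : IsSmoothImmersion f)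
    (hN : IsGaussMap f N) {ν : E3} (hν : ∀ p, N p = ν) (p q : M) :
    inner ℝ (f p) ν = inner ℝ (f q) ν := by
  have hk : ContMDiff (𝓡 2) 𝓘(ℝ, ℝ) ∞ (fun p => inner ℝ (f p) ν) :=
    (contDiff_id.inner ℝ contDiff_const).contMDiff.comp hf.smooth
  refine eq_of_fderiv_chart_eq_zero hk (fun p x hx => ?_) p q
  have hd := ((contDiffOn_comp_chart_symm hf.smooth p).contDiffAt
    ((chartAt E2 p).open_target.mem_nhds hx)).differentiableAt (by simp)
  obtain ⟨J, -, hJ⟩ := exists_fderiv_comp_chart_symm p hx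
  ext1 v
  rw [fderiv_inner_apply ℝ hd (differentiableAt_const ν), hJ f hf.smooth]
  have := hN.normal ((chartAt E2 p).symm x) (J v)
  rw [hν] at this
  simpa using this

end Surface

/-! ### The theorem. -/

theorem mainTheorem6
    (I : Set ℝ) (hI_open : IsOpen I) (hI_conn : I.OrdConnected)
    (φ : ℝ → ℝ) (hφ_smooth : ContDiffOn ℝ ∞ φ I) (hφ_mono : StrictMonoOn φ I)
    (lam : ℝ) (hlam : 0 < lam)
    (hφ : ∀ t ∈ I, 0 ≤ deriv (deriv φ) t + lam * (deriv φ t) ^ 2)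
    {M : Type*} [TopologicalSpace M] [ChartedSpace (EuclideanSpace ℝ (Fin 2)) M]
    [IsManifold (𝓡 2) ∞ M] [ConnectedSpace M]
    (f N : M → E3) (hf : IsPhiMinimal φ I f N)
    (hH : ∀ p, meanCurvature f N p ≤ 0)
    (hzero : ∃ p, meanCurvature f N p = 0) :
    (∀ p, meanCurvature f N p = 0) ∧
      ∃ P : AffineSubspace ℝ E3, IsVerticalPlane P ∧ Set.range f ⊆ (P : Set E3) := by
  have hpos : ∀ p, 0 < deriv φ (f p 2) := fun p =>
    deriv_pos_of_strictMonoOn_of_nonneg hI_open hI_conn hφ_smooth hφ_mono hφ (hf.mem_slab p)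
  have hmc := hf.meanCurvature_eq_deriv hI_open hφ_smooth
  have hnn : ∀ p, 0 ≤ inner ℝ (N p) e3 := fun p => by
    have h := hH p
    rw [hmc] at h
    exact nonneg_of_mul_nonneg_right (by linarith) (hpos p)
  obtain ⟨p₀, hp₀⟩ := hzero
  have hp₀' : inner ℝ (N p₀) e3 = 0 := by
    rw [hmc, neg_eq_zero] at hp₀
    exact (mul_eq_zero.1 hp₀).resolve_left (hpos p₀).ne'
  have hv := hf.inner_e3_eq_zero hI_open hφ_smooth hnn ⟨p₀, hp₀'⟩
  have hH0 : ∀ p, meanCurvature f N p = 0 := fun p => by rw [hmc, hv, mul_zero, neg_zero]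
  -- The plane through `f p₀` orthogonal to `N p₀`; verticality is `⟨N p₀, e₃⟩ = 0`.
  refine ⟨hH0, AffineSubspace.mk' (f p₀) (ℝ ∙ N p₀)ᗮ, ⟨?_, ?_⟩, ?_⟩
  · rw [AffineSubspace.direction_mk']
    have : Fact (Module.finrank ℝ E3 = 2 + 1) := ⟨by simp⟩
    refine Submodule.finrank_orthogonal_span_singleton fun h => ?_
    have := hf.gaussMap.norm_eq_one p₀
    rw [h, norm_zero] at this
    exact zero_ne_one this
  · rw [AffineSubspace.direction_mk', Submodule.mem_orthogonal_singleton_iff_inner_right]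
    exact hv p₀
  · rintro _ ⟨p, rfl⟩
    have hconst := hf.gaussMap.eq_of_minimal_of_vertical hf.immersion hH0 hv
    rw [SetLike.mem_coe, AffineSubspace.mem_mk', Submodule.mem_orthogonal_singleton_iff_inner_left,
      vsub_eq_sub, inner_sub_left, sub_eq_zero]
    exact hf.gaussMap.inner_eq_of_const hf.immersion (fun q => hconst q p₀) p p₀
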